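/- Let $\nu>1$ be an integer, $C_\nu$ the cyclic group of order $\nu$, and $[a,b]=\{t\in\mathbb Z: a\le t\le b\}$, $[n]=[1,n]$ (empty if $n<1$). For a finite set $S$ of positive integers let $Q_S(\nu)=\prod_{s\in S}C_\nu$, and regard $Q_I(\nu)$ ($I\subseteq S$) as the subgroup of $Q_S(\nu)$ of elements that are trivial outside $I$. Put $\mathcal N_S(\nu)=\{Q_I(\nu): I\subseteq S\}$, $Q_n(\nu)=Q_{[n-1]}(\nu)$ and $\mathcal N_n(\nu)=\mathcal N_{[n-1]}(\nu)$ for $n\ge 0$. Let $\mathrm{cf}(G)$ denote the space of complex class functions of a group $G$. *Supercharacters.* For $N\in\mathcal N_S(\nu)$ let $N_\circ$ be the set of $g\in N$ lying in no $M\in\mathcal N_S(\nu)$ covered by $N$, and let $X^{N^\bullet}$ be the set of irreducible characters $\psi$ of $Q_S(\nu)$ with $N\subseteq\ker\psi$ and $O\not\subseteq\ker\psi$ for every $O\in\mathcal N_S(\nu)$ covering $N$. The space $\mathrm{scf}(\mathcal N_n(\nu))\subseteq\mathrm{cf}(Q_n(\nu))$ consists of the functions constant on every $N_\circ$, $N\in\mathcal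 N_n(\nu)$. For $I\subseteq S$ let $\chi^I(\nu)=\sum_{\psi}\psi(\mathbf 0)\,\psi$, summed over $\psi\in X^{Q_I(\nu)^\bullet}$, and $\dot\chi^I(\nu)=\chi^I(\nu)/\chi^I(\nu)(\mathbf 0)$, where $\mathbf 0$ is the identity. *Product.* For $V=U\sqcup W$ and class functions $\phi$ of $Q_U(\nu)$, $\psi$ of $Q_W(\nu)$, let $(\phi\otimes_U\psi)(a,b)=\phi(a)\psi(b)$ on $Q_V(\nu)=Q_U(\nu)\times Q_W(\nu)$. For $S=\{s_1<\dots<s_r\}$ let $\iota_S^*:\mathrm{cf}(Q_{r+1}(\nu))\to\mathrm{cf}(Q_S(\nu))$ be the pullback along the isomorphism $Q_S(\nu)\to Q_{r+1}(\nu)$ that relabels the index $s_i$ as $i$. Let $\theta=(\mathbf{reg}-\mathbf 1)/(\nu-1)$ on $C_\nu$, where $\mathbf{reg}$ is the regular character and $\mathbf 1$ the trivial one; for $m\ge1$ and $\phi\in\mathrm{cf}(Q_m(\nu))$ let $\phi\otimes_1\theta\in\mathrm{cf}(Q_{m+1}(\nu))$ have $\theta$ at the index $m$. For $A\subseteq[m+n]$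 with complement $A^c$ in $[m+n]$, let $e(A)$ be the set of right end points, other than $m+n$, of the maximal intervals contained in $A$, and $\bar e(A)=e(A)\sqcup e(A^c)$. For $|A|=n$ and $m,n\ge1$ put $$\mathbf m_A(\phi,\psi)=\dot\chi^{e(A)}(\nu)\otimes_{\bar e(A)}\Big(\big(\iota_{A^c}^*(\phi\otimes_1\theta)\otimes_{A^c}\iota_A^*(\psi\otimes_1\theta)\big)\big\downarrow_{Q_{[m+n-1]\setminus\bar e(A)}(\nu)}\Big),$$ where $\dot\chi^{e(A)}(\nu)$ is taken on $Q_{\bar e(A)}(\nu)$. If $m=0$ or $n=0$, then $\mathbf m_A(\phi,\psi)$ is the scalar product, with $\mathrm{cf}(Q_0(\nu))=\mathbb C\mathbf 1_0\cong\mathbb C$. Let $\mathbf m=\sum_{A\subseteq[m+n],\,|A|=n}\mathbf m_A:\mathrm{cf}(Q_m(\nu))\times\mathrm{cf}(Q_n(\nu))\to\mathrm{cf}(Q_{m+n}(\nu))$, extended bilinearly to $\bigoplus_n\mathrm{cf}(Q_n(\nu))$. *Coproduct.* For $\phi\in\mathrm{cf}(Q_n(\nu))$ let $\blacktriangle_0(\phi)=\mathbf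 1_0\otimes\phi$, $\blacktriangle_n(\phi)=\phi\otimes\mathbf 1_0$, and, for $1\le k<n$, let $\blacktriangle_k(\phi)=T\big(\phi\downarrow_{Q_{[k-1]\sqcup[k+1,n-1]}(\nu)}\big)$, where $T$ is the inverse of the isomorphism $\mathrm{cf}(Q_k(\nu))\otimes\mathrm{cf}(Q_{n-k}(\nu))\to\mathrm{cf}(Q_{[k-1]\sqcup[k+1,n-1]}(\nu))$, $\phi_1\otimes\phi_2\mapsto\phi_1\otimes_{[k-1]}\iota_{[k+1,n-1]}^*(\phi_2)$. Let $\blacktriangle=\sum_{k=0}^n\blacktriangle_k$, extended linearly to $\bigoplus_n\mathrm{cf}(Q_n(\nu))$. *Quasisymmetric functions.* For a composition $\alpha=(\alpha_1,\dots,\alpha_l)$ of $n$ let $\mathrm{set}(\alpha)=\{\alpha_1,\alpha_1+\alpha_2,\dots,\alpha_1+\dots+\alpha_{l-1}\}$, $M_\alpha=\sum_{i_1<\dots<i_l}x_{i_1}^{\alpha_1}\cdots x_{i_l}^{\alpha_l}$ and $L_\alpha=\sum x_{i_1}\cdots x_{i_n}$, the sum being over $i_1\le\dots\le i_n$ with $i_j<i_{j+1}$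 for $j\in\mathrm{set}(\alpha)$. $\mathsf{QSym}$ is the complex span of the $M_\alpha$, with the product of power series and the coproduct $\triangle M_\alpha=\sum_{\beta\cdot\gamma=\alpha}M_\beta\otimes M_\gamma$ (concatenation). For $I=\{s_1<\dots<s_i\}\subseteq[n-1]$ let $\mathrm{comp}(I)=(s_1,s_2-s_1,\dots,n-s_i)$, the empty composition if $n=0$. **Theorem.** For every integer $\nu>1$: (a) $\mathbf m$ and $\blacktriangle$ restrict to $\bigoplus_{n\ge0}\mathrm{scf}(\mathcal N_n(\nu))$ and are the product and coproduct of a Hopf algebra structure over $\mathbb C$ on it. (b) There is exactly one linear map $\mathrm{ch}_\nu:\bigoplus_{n\ge0}\mathrm{scf}(\mathcal N_n(\nu))\to\mathsf{QSym}$ with $\dot\chi^I(\nu)\mapsto L_{\mathrm{comp}(I)}$ for all $n\ge0$ and $I\subseteq[n-1]$, and it is an isomorphism of Hopf algebras, $\mathsf{QSym}$ being a Hopf algebra with the product and coproduct above. -/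

import Mathlib

open scoped TensorProduct DirectSum

noncomputable section

namespace QSymCat

/-! ## Supercharacter theory of a sublattice of normal subgroups -/

section Supercharacters

variable {G : Type} [Group G]

/-- The set `Irr(G)` of characters of the irreducible finite-dimensional complex
representations of `G`. -/
def Irr (G : Type) [Group G] : Set (G → ℂ) :=
  {ψ | ∃ (d : ℕ) (ρ : Representation ℂ G (Fin d → ℂ)), ρ.IsIrreducible ∧ ρ.character = ψ}

/-- `O` covers `R` in the family `𝓝` of subgroups ordered by inclusion. -/
def Covers (𝓝 : Set (Subgroup G)) (R O : Subgroup G) : Prop :=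
  R ∈ 𝓝 ∧ O ∈ 𝓝 ∧ R < O ∧ ∀ K ∈ 𝓝, R < K → ¬ K < O

/-- The superclass `N_∘`: the elements of `N` lying in no `M ∈ 𝓝` that is covered by `N`. -/
def superclass (𝓝 : Set (Subgroup G)) (N : Subgroup G) : Set G :=
  {g | g ∈ N ∧ ∀ M, Covers 𝓝 M N → g ∉ M}

/-- The block `X^{N^•}` of irreducible characters whose kernel `{g | ψ g = ψ 1}` contains `N`
but no `O ∈ 𝓝` that covers `N`. -/
def charBlock (𝓝 : Set (Subgroup G)) (N : Subgroup G) : Set (G → ℂ) :=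
  {ψ | ψ ∈ Irr G ∧ (∀ g ∈ N, ψ g = ψ 1) ∧ ∀ O, Covers 𝓝 N O → ¬ ∀ g ∈ O, ψ g = ψ 1}

/-- The supercharacter `χ^C = ∑_{ψ ∈ C} ψ(1) ψ` of a block `C` of irreducible characters. -/
def supercharacter (C : Set (G → ℂ)) : G → ℂ :=
  fun g => ∑ᶠ ψ ∈ C, ψ 1 * ψ g

/-- The supercharacter function space of the normal lattice supercharacter theory attached
to `𝓝`: the functions constant on every superclass. -/
def superFunctions (𝓝 : Set (Subgroup G)) : Submodule ℂ (G → ℂ) where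
  carrier := {f | ∀ N ∈ 𝓝, ∀ g ∈ superclass 𝓝 N, ∀ h ∈ superclass 𝓝 N, f g = f h}
  add_mem' := by
    intro a b ha hb N hN g hg h hh
    simp only [Pi.add_apply, ha N hN g hg h hh, hb N hN g hg h hh]
  zero_mem' := by
    intro N _ g _ h _
    rfl
  smul_mem' := by
    intro c a ha N hN g hg h hh
    simp only [Pi.smul_apply, ha N hN g hg h hh]

end Supercharacters

/-! ## The groups `Q_S(ν)` and their class functions -/

/-- The cyclic group `C_ν`, written multiplicatively. -/
abbrev Cyc (ν : ℕ) : Type := Multiplicative (ZMod ν)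

/-- The group `Q_S(ν)`, the direct product of copies of `C_ν` indexed by `S`. -/
abbrev Q (ν : ℕ) (S : Finset ℕ) : Type := S → Cyc ν

/-- The space of class functions of `Q_S(ν)`. As `Q_S(ν)` is abelian these are all functions. -/
abbrev Cf (ν : ℕ) (S : Finset ℕ) : Type := Q ν S → ℂ

/-- The index set `[n - 1] = {1, …, n - 1}` (empty for `n = 0, 1`), so that
`Q_n(ν) = Q ν (idx n)`. -/
abbrev idx (n : ℕ) : Finset ℕ := Finset.Icc 1 (n - 1)

variable (ν : ℕ)

/-- `Q_I(ν)` as a subgroup of `Q_S(ν)`. -/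
def subQ (S I : Finset ℕ) : Subgroup (Q ν S) where
  carrier := {g | ∀ s : S, (s : ℕ) ∉ I → g s = 1}
  mul_mem' := by
    intro a b ha hb s hs
    simp only [Pi.mul_apply, ha s hs, hb s hs, mul_one]
  one_mem' := by
    intro s _
    rfl
  inv_mem' := by
    intro a ha s hs
    simp only [Pi.inv_apply, ha s hs, inv_one]

/-- The sublattice `𝒩_S(ν) = {Q_I(ν) | I ⊆ S}`. -/
def lattice (S : Finset ℕ) : Set (Subgroup (Q ν S)) :=
  {K | ∃ I ⊆ S, K = subQ ν S I}

/-- `scf(𝒩_n(ν))`. -/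
def scf (n : ℕ) : Submodule ℂ (Cf ν (idx n)) :=
  superFunctions (lattice ν (idx n))

/-- The supercharacter `χ^I(ν)` of `Q_S(ν)`. -/
def chi (S I : Finset ℕ) : Cf ν S :=
  supercharacter (charBlock (lattice ν S) (subQ ν S I))

/-- The normalized supercharacter `χ̇^I(ν) = χ^I(ν) / χ^I(ν)(1)` of `Q_S(ν)`. -/
def chiDot (S I : Finset ℕ) : Cf ν S :=
  fun g => chi ν S I g / chi ν S I 1

/-- The function `(reg - 𝟙) / (ν - 1)` on `C_ν`, where `reg` is the character of the regular
representation. -/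
def regDot [NeZero ν] : Cyc ν → ℂ :=
  fun g => ((Representation.leftRegular ℂ (Cyc ν)).character g - 1) / ((ν : ℂ) - 1)

variable {ν}

/-- The canonical map `Q_V(ν) → Q_U(ν)` that keeps the components indexed by `U ∩ V` and
fills the others with the identity. It is the projection if `U ⊆ V`, the inclusion if `V ⊆ U`
and the identity if `U = V`. -/
def tr {V : Finset ℕ} (U : Finset ℕ) (g : Q ν V) : Q ν U :=
  fun s => if h : (s : ℕ) ∈ V then g ⟨s, h⟩ else 1

/-- The restriction of a class function from `Q_V(ν)` to its subgroup `Q_U(ν)`, `U ⊆ V`. -/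
def res {V : Finset ℕ} (U : Finset ℕ) (φ : Cf ν V) : Cf ν U :=
  fun g => φ (tr V g)

/-- For `V = U ⊔ W`, the class function `φ ⊗_U ψ` of `Q_V(ν) = Q_U(ν) × Q_W(ν)`. -/
def tens {U W : Finset ℕ} (V : Finset ℕ) (φ : Cf ν U) (ψ : Cf ν W) : Cf ν V :=
  fun g => φ (tr U g) * ψ (tr W g)

/-- The isomorphism `ι_S : Q_S(ν) → Q_{|S|+1}(ν)` given by the standardization of indices: for
`S = {s_1 < s_2 < ⋯}` the `i`-th component of `ι_S g` is the `s_i`-th component of `g`. -/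
def iota (S : Finset ℕ) (g : Q ν S) : Q ν (idx (S.card + 1)) :=
  fun i => g (S.orderIsoOfFin rfl
    ⟨(i : ℕ) - 1, by have := Finset.mem_Icc.1 i.2; omega⟩)

/-- The pullback `ι_S^* : cf(Q_r(ν)) → cf(Q_S(ν))` for a set `S` with `|S| + 1 = r`; then `tr`
is the identity `Q_{|S|+1}(ν) = Q_r(ν)`. -/
def iotaStar {r : ℕ} (S : Finset ℕ) (φ : Cf ν (idx r)) : Cf ν S :=
  fun g => φ (tr (idx r) (iota S g))

/-- `φ ⊗_1 θ ∈ cf(Q_{m+1}(ν))` for `φ ∈ cf(Q_m(ν))`, `m ≥ 1`, and `θ ∈ cf(C_ν)` placed at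
the last index `m`. -/
def tensOne {m : ℕ} (φ : Cf ν (idx m)) (θ : Cyc ν → ℂ) : Cf ν (idx (m + 1)) :=
  tens (W := {m}) (idx (m + 1)) φ (fun h => θ (h ⟨m, Finset.mem_singleton_self m⟩))

/-! ## The product -/

/-- `e(A)` for `A ⊆ [N]`: the right end points, other than `N`, of the maximal intervals
contained in `A`. -/
def endPts (N : ℕ) (A : Finset ℕ) : Finset ℕ :=
  A.filter fun b => b ≠ N ∧ b + 1 ∉ A

/-- `ē(A) = e(A) ⊔ e(Aᶜ)` for `A ⊆ [N]`. -/
def endPtsBar (N : ℕ) (A : Finset ℕ) : Finset ℕ :=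
  endPts N A ∪ endPts N (Finset.Icc 1 N \ A)

/-- The class function `s_A(φ, ψ)` of `Q_{m+n+1}(ν)`, for an `n`-element subset `A` of
`[m + n]`. -/
def sA [NeZero ν] {m n : ℕ} (A : Finset ℕ) (φ : Cf ν (idx m)) (ψ : Cf ν (idx n)) :
    Cf ν (idx (m + n + 1)) :=
  tens (idx (m + n + 1))
    (iotaStar (Finset.Icc 1 (m + n) \ A) (tensOne φ (regDot ν)))
    (iotaStar A (tensOne ψ (regDot ν)))

/-- The class function `𝐦_A(φ, ψ)` of `Q_{m+n}(ν)`. If `m = 0` or `n = 0`, it is the scalar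
product, where a class function of the trivial group `Q_0(ν)` is regarded as a scalar. -/
def mA [NeZero ν] {m n : ℕ} (A : Finset ℕ) (φ : Cf ν (idx m)) (ψ : Cf ν (idx n)) :
    Cf ν (idx (m + n)) :=
  if m = 0 then fun g => φ 1 * ψ (tr (idx n) g)
  else if n = 0 then fun g => φ (tr (idx m) g) * ψ 1
  else tens (idx (m + n))
    (chiDot ν (endPtsBar (m + n) A) (endPts (m + n) A))
    (res (Finset.Icc 1 (m + n - 1) \ endPtsBar (m + n) A) (sA A φ ψ))

variable (ν) in
/-- The bilinear map `𝐦 = ∑_A 𝐦_A : cf(Q_m(ν)) × cf(Q_n(ν)) → cf(Q_{m+n}(ν))`, the sum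
being over the `n`-element subsets `A` of `[m + n]`. -/
def mulComponent [NeZero ν] (m n : ℕ) :
    Cf ν (idx m) →ₗ[ℂ] Cf ν (idx n) →ₗ[ℂ] Cf ν (idx (m + n)) :=
  ∑ A ∈ (Finset.Icc 1 (m + n)).powersetCard n,
    LinearMap.mk₂ ℂ (fun φ ψ => mA A φ ψ)
      (by
        intro φ φ' ψ; ext g
        simp only [mA]; split_ifs <;> simp [tens, res, sA, iotaStar, tensOne] <;> ring)
      (by
        intro c φ ψ; ext g
        simp only [mA]; split_ifs <;> simp [tens, res, sA, iotaStar, tensOne] <;> ring)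
      (by
        intro φ ψ ψ'; ext g
        simp only [mA]; split_ifs <;> simp [tens, res, sA, iotaStar, tensOne] <;> ring)
      (by
        intro c φ ψ; ext g
        simp only [mA]; split_ifs <;> simp [tens, res, sA, iotaStar, tensOne] <;> ring)

variable (ν) in
/-- The direct sum `⨁_n cf(Q_n(ν))`. -/
abbrev CfSum : Type := ⨁ n : ℕ, Cf ν (idx n)

variable (ν) in
/-- The direct sum `⨁_n scf(𝒩_n(ν))`. -/
abbrev ScfSum : Type := ⨁ n : ℕ, scf ν n

variable (ν) in
/-- The inclusion of `⨁_n scf(𝒩_n(ν))` into `⨁_n cf(Q_n(ν))`. -/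
def incl : ScfSum ν →ₗ[ℂ] CfSum ν :=
  DirectSum.lmap fun n => (scf ν n).subtype

variable (ν) in
/-- The product `𝐦` on `⨁_n cf(Q_n(ν))`. -/
def product [NeZero ν] : CfSum ν →ₗ[ℂ] CfSum ν →ₗ[ℂ] CfSum ν :=
  DirectSum.toModule ℂ ℕ _ fun m =>
    (DirectSum.toModule ℂ ℕ _ fun n =>
      ((mulComponent ν m n).compr₂
        (DirectSum.lof ℂ ℕ (fun n => Cf ν (idx n)) (m + n))).flip).flip

/-! ## The coproduct -/

/-- The index set `[k - 1] ⊔ [k + 1, n - 1]`. -/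
abbrev cutIdx (n k : ℕ) : Finset ℕ := Finset.Icc 1 (k - 1) ∪ Finset.Icc (k + 1) (n - 1)

variable (ν) in
/-- The linear map `φ ⊗ ψ ↦ φ ⊗_{[k-1]} ι_{[k+1,n-1]}^*(ψ)`, from
`cf(Q_k(ν)) ⊗ cf(Q_{n-k}(ν))` to the class functions of `Q_{[k-1] ⊔ [k+1,n-1]}(ν)`. -/
def glue (n k : ℕ) :
    Cf ν (idx k) ⊗[ℂ] Cf ν (idx (n - k)) →ₗ[ℂ] Cf ν (cutIdx n k) :=
  TensorProduct.lift <| LinearMap.mk₂ ℂ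
    (fun φ ψ => tens (cutIdx n k) φ (iotaStar (Finset.Icc (k + 1) (n - 1)) ψ))
    (by intro φ φ' ψ; ext g; simp [tens, iotaStar, add_mul])
    (by intro c φ ψ; ext g; simp [tens, iotaStar, mul_assoc])
    (by intro φ ψ ψ'; ext g; simp [tens, iotaStar, mul_add])
    (by intro c φ ψ; ext g; simp [tens, iotaStar, mul_left_comm])

variable (ν) in
theorem glue_index_bijective [NeZero ν] {n k : ℕ} (hk : 1 ≤ k) (hn : k < n) :
    Function.Bijective fun g : Q ν (cutIdx n k) =>
      ((tr (idx (n - k)) (iota (Finset.Icc (k + 1) (n - 1)) (tr _ g)), tr (idx k) g) :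
        Q ν (idx (n - k)) × Q ν (idx k)) := by
  rw [Fintype.bijective_iff_injective_and_card]
  refine ⟨?_, ?_⟩
  · intro g g' h
    obtain ⟨h2, h1⟩ := Prod.mk.inj h
    ext ⟨s, hs⟩
    by_cases hsk : s ∈ Finset.Icc 1 (k - 1)
    · have := congrFun h1 ⟨s, hsk⟩
      simp only [tr, hs, dif_pos] at this
      rw [this]
    · have hs' : s ∈ Finset.Icc (k + 1) (n - 1) := by
        rcases Finset.mem_union.1 hs with h | h
        · exact absurd h hsk
        · exact h
      obtain ⟨j, hj⟩ := ((Finset.Icc (k + 1) (n - 1)).orderIsoOfFin rfl).surjective ⟨s, hs'⟩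
      have hjlt := j.2
      have hcard : (Finset.Icc (k + 1) (n - 1)).card = n - 1 - k := by simp
      have hj1 : (j : ℕ) + 1 ∈ idx (n - k) := Finset.mem_Icc.2 (by omega)
      have hj2 : (j : ℕ) + 1 ∈ idx ((Finset.Icc (k + 1) (n - 1)).card + 1) :=
        Finset.mem_Icc.2 (by omega)
      have := congrFun h2 ⟨(j : ℕ) + 1, hj1⟩
      simp only [tr, hj2, dif_pos, iota, Nat.add_sub_cancel, Fin.eta, hj, hs] at this
      rw [this]
  · have hd : Disjoint (Finset.Icc 1 (k - 1)) (Finset.Icc (k + 1) (n - 1)) := by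
      rw [Finset.disjoint_left]
      intro a ha hb
      have := Finset.mem_Icc.1 ha
      have := Finset.mem_Icc.1 hb
      omega
    simp only [Fintype.card_prod, Fintype.card_fun, Fintype.card_coe, ← pow_add,
      Finset.card_union_of_disjoint hd, Nat.card_Icc]
    congr 1
    omega

variable (ν) in
theorem glue_bijective [NeZero ν] {n k : ℕ} (hk : 1 ≤ k) (hn : k < n) :
    Function.Bijective (glue ν n k) := by
  classical
  let e := Equiv.ofBijective _ (glue_index_bijective ν hk hn)
  let E : Cf ν (idx k) ⊗[ℂ] Cf ν (idx (n - k)) ≃ₗ[ℂ] Cf ν (cutIdx n k) :=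
    (TensorProduct.piScalarRight ℂ ℂ (Cf ν (idx k)) (Q ν (idx (n - k)))).trans
      ((LinearEquiv.curry ℂ ℂ (Q ν (idx (n - k))) (Q ν (idx k))).symm.trans
        (LinearEquiv.funCongrLeft ℂ ℂ e))
  have hE : glue ν n k = E.toLinearMap := by
    apply TensorProduct.ext'
    intro φ ψ
    ext g
    simp [glue, E, e, tens, iotaStar, Function.uncurry, LinearMap.funLeft, mul_comm]
  rw [hE]
  exact E.bijective

variable (ν) in
/-- The inverse `T` of the isomorphism `glue`. -/
def unglue [NeZero ν] {n k : ℕ} (hk : 1 ≤ k) (hn : k < n) :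
    Cf ν (cutIdx n k) →ₗ[ℂ] Cf ν (idx k) ⊗[ℂ] Cf ν (idx (n - k)) :=
  (LinearEquiv.ofBijective (glue ν n k) (glue_bijective ν hk hn)).symm

/-- Restriction of class functions as a linear map. -/
def resLin {V : Finset ℕ} (U : Finset ℕ) : Cf ν V →ₗ[ℂ] Cf ν U :=
  LinearMap.funLeft ℂ ℂ (tr V)

variable (ν) in
/-- The map `▲_k : cf(Q_n(ν)) → cf(Q_k(ν)) ⊗ cf(Q_{n-k}(ν))`, for `0 ≤ k ≤ n`. In the cases
`k = 0` and `k = n`, `resLin` is the identity of `cf(Q_n(ν))`, and `1` is the trivial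
character `𝟙_0` of `Q_0(ν)`. -/
def coproductComponent [NeZero ν] (n k : ℕ) :
    Cf ν (idx n) →ₗ[ℂ] Cf ν (idx k) ⊗[ℂ] Cf ν (idx (n - k)) :=
  if h : 1 ≤ k ∧ k < n then unglue ν h.1 h.2 ∘ₗ resLin (cutIdx n k)
  else if k = 0 then TensorProduct.mk ℂ _ _ 1 ∘ₗ resLin (idx (n - k))
  else (TensorProduct.mk ℂ _ _).flip 1 ∘ₗ resLin (idx k)

variable (ν) in
/-- The coproduct `▲ = ∑_{k=0}^n ▲_k` on `⨁_n cf(Q_n(ν))`. -/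
def coproduct [NeZero ν] : CfSum ν →ₗ[ℂ] CfSum ν ⊗[ℂ] CfSum ν :=
  DirectSum.toModule ℂ ℕ _ fun n => ∑ k ∈ Finset.range (n + 1),
    TensorProduct.map (DirectSum.lof ℂ ℕ (fun n => Cf ν (idx n)) k)
      (DirectSum.lof ℂ ℕ (fun n => Cf ν (idx n)) (n - k)) ∘ₗ coproductComponent ν n k

/-! ## Quasisymmetric functions -/

/-- A composition: a finite tuple of positive integers. -/
abbrev Comp : Type := List ℕ+

/-- The size of a composition. -/
def Comp.size (α : Comp) : ℕ := (α.map fun a => (a : ℕ)).sum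

/-- `set(α) = {α_1, α_1 + α_2, …, α_1 + ⋯ + α_{l-1}}`. -/
def Comp.set (α : Comp) : Finset ℕ :=
  (Finset.Ico 1 α.length).image fun i => Comp.size (α.take i)

/-- The composition `comp(I) = (s_1, s_2 - s_1, …, s_i - s_{i-1}, n - s_i)` of `n` attached to
a subset `I = {s_1 < ⋯ < s_i}` of `[n - 1]`; it is the empty composition if `n = 0`. (For such
`I` all these differences are positive, and `Nat.toPNat'` does not change them.) -/
def comp (n : ℕ) (I : Finset ℕ) : Comp :=
  if n = 0 then []
  else List.zipWith (fun a b => (b - a).toPNat') (0 :: I.sort (· ≤ ·)) (I.sort (· ≤ ·) ++ [n])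

/-- The monomial quasisymmetric function `M_α`, a power series in the variables
`x_0, x_1, …`: the coefficient at a monomial `d` is the number of sequences
`i_1 < ⋯ < i_l` with `x_{i_1}^{α_1} ⋯ x_{i_l}^{α_l} = x^d`. -/
def M (α : Comp) : MvPowerSeries ℕ ℂ := fun d =>
  (Nat.card {i : Fin α.length → ℕ //
    StrictMono i ∧ ∑ j, Finsupp.single (i j) (α.get j : ℕ) = d} : ℂ)

/-- The fundamental quasisymmetric function `L_α`: the coefficient at a monomial `d` is the
number of sequences `i_1 ≤ ⋯ ≤ i_n`, with `i_j < i_{j+1}` for `j ∈ set(α)`, such that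
`x_{i_1} ⋯ x_{i_n} = x^d`. -/
def L (α : Comp) : MvPowerSeries ℕ ℂ := fun d =>
  (Nat.card {i : Fin α.size → ℕ //
    Monotone i ∧ (∀ a b : Fin α.size, (b : ℕ) = a + 1 → (b : ℕ) ∈ α.set → i a < i b) ∧
      ∑ j, Finsupp.single (i j) 1 = d} : ℂ)

/-- The space `QSym` of quasisymmetric functions, spanned by the `M_α`. -/
def QSym : Submodule ℂ (MvPowerSeries ℕ ℂ) := Submodule.span ℂ (Set.range M)

theorem eq_of_monomial_eq (α β : Comp) (i : Fin β.length → ℕ) (hi : StrictMono i)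
    (h : ∑ j, Finsupp.single (i j) (β.get j : ℕ) =
      ∑ j : Fin α.length, Finsupp.single (j : ℕ) (α.get j : ℕ)) :
    β = α ∧ ∀ j, i j = j := by
  have key : ∀ (γ : Comp) (f : Fin γ.length → ℕ), StrictMono f → ∀ j,
      (∑ j, Finsupp.single (f j) (γ.get j : ℕ)) (f j) = γ.get j := by
    intro γ f hf j
    rw [Finsupp.finsetSum_apply, Finset.sum_eq_single j]
    · simp
    · intro b _ hb
      exact Finsupp.single_eq_of_ne (fun h => hb (hf.injective h.symm))
    · simp
  have key2 : ∀ (γ : Comp) (f : Fin γ.length → ℕ) (x : ℕ),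
      (∑ j, Finsupp.single (f j) (γ.get j : ℕ)) x ≠ 0 → x ∈ Set.range f := by
    intro γ f x hx
    rw [Finsupp.finsetSum_apply] at hx
    obtain ⟨j, _, hj⟩ := Finset.exists_ne_zero_of_sum_ne_zero hx
    refine ⟨j, ?_⟩
    by_contra hne
    exact hj (Finsupp.single_eq_of_ne (fun h => hne h.symm))
  have hv : StrictMono (fun j : Fin α.length => (j : ℕ)) := fun a b hab => hab
  have hr : Set.range i = Set.range (fun j : Fin α.length => (j : ℕ)) := by
    apply Set.Subset.antisymm
    · rintro _ ⟨j, rfl⟩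
      apply key2 α
      rw [← h, key β i hi j]
      exact (β.get j).ne_zero
    · rintro _ ⟨j, rfl⟩
      apply key2 β
      rw [h, key α _ hv j]
      exact (α.get j).ne_zero
  have hl : β.length = α.length := by
    have h1 := Set.ncard_range_of_injective hi.injective
    have h2 := Set.ncard_range_of_injective hv.injective
    rw [hr, h2] at h1
    simpa using h1.symm
  have hij : ∀ j : Fin β.length, i j = j := by
    have : i = fun j : Fin β.length => (j : ℕ) := by
      apply (StrictMono.range_inj hi (fun a b hab => hab)).1
      rw [hr]
      ext x
      simp [hl]
    exact fun j => congrFun this j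
  refine ⟨List.ext_get hl ?_, hij⟩
  intro k hk1 hk2
  have h1 := key β i hi ⟨k, hk1⟩
  have h2 := key α _ hv ⟨k, hk2⟩
  rw [h, hij] at h1
  exact PNat.coe_injective (h1.symm.trans h2)

theorem M_apply_packed (α β : Comp) :
    M β (∑ j : Fin α.length, Finsupp.single (j : ℕ) (α.get j : ℕ)) =
      if β = α then 1 else 0 := by
  unfold M
  split_ifs with hβ
  · subst hβ
    have : Nat.card {i : Fin β.length → ℕ // StrictMono i ∧
        ∑ j, Finsupp.single (i j) (β.get j : ℕ) =
          ∑ j : Fin β.length, Finsupp.single (j : ℕ) (β.get j : ℕ)} = 1 := by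
      rw [Nat.card_eq_one_iff_unique]
      refine ⟨⟨?_⟩, ⟨⟨fun j => j, fun a b hab => hab, rfl⟩⟩⟩
      rintro ⟨i, hi, h⟩ ⟨i', hi', h'⟩
      apply Subtype.ext
      funext j
      exact ((eq_of_monomial_eq β β i hi h).2 j).trans
        ((eq_of_monomial_eq β β i' hi' h').2 j).symm
    rw [this, Nat.cast_one]
  · have : IsEmpty {i : Fin β.length → ℕ // StrictMono i ∧
        ∑ j, Finsupp.single (i j) (β.get j : ℕ) =
          ∑ j : Fin α.length, Finsupp.single (j : ℕ) (α.get j : ℕ)} :=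
      ⟨fun x => hβ (eq_of_monomial_eq α β x.1 x.2.1 x.2.2).1⟩
    rw [Nat.card_of_isEmpty, Nat.cast_zero]

theorem linearIndependent_M : LinearIndependent ℂ M := by
  classical
  rw [linearIndependent_iff']
  intro s c h α hα
  have h1 := congrFun h (∑ j : Fin α.length, Finsupp.single (j : ℕ) (α.get j : ℕ))
  have h2 : (∑ β ∈ s, c β • M β) (∑ j : Fin α.length, Finsupp.single (j : ℕ) (α.get j : ℕ)) =
      ∑ β ∈ s, c β * M β (∑ j : Fin α.length, Finsupp.single (j : ℕ) (α.get j : ℕ)) := by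
    exact Finset.sum_apply _ s fun β => c β • M β
  rw [h2] at h1
  simp only [M_apply_packed, mul_ite, mul_one, mul_zero, Finset.sum_ite_eq', hα, if_true] at h1
  exact h1

/-- The basis of monomial quasisymmetric functions. -/
def basisM : Module.Basis Comp ℂ QSym := Module.Basis.span linearIndependent_M

/-- The coproduct of `QSym`: `△ M_α` is the sum of all `M_β ⊗ M_γ` with `β · γ = α`, where
`β · γ` is the concatenation. -/
def coproductQSym : QSym →ₗ[ℂ] QSym ⊗[ℂ] QSym :=
  basisM.constr ℂ fun α => ∑ k ∈ Finset.range (α.length + 1),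
    basisM (α.take k) ⊗ₜ[ℂ] basisM (α.drop k)

variable (ν) in
/-- The property characterizing `ch_ν`: it sends `χ̇^I(ν)`, for `I ⊆ [n - 1]`, to `L_{comp(I)}`.
(The normalized supercharacter `χ̇^I(ν)` belongs to `scf(𝒩_n(ν))`.) -/
def SendsChiToL (f : ScfSum ν →ₗ[ℂ] QSym) : Prop :=
  ∀ n : ℕ, ∀ I ⊆ idx n, ∃ h : chiDot ν (idx n) I ∈ scf ν n,
    (f (DirectSum.lof ℂ ℕ (fun n => scf ν n) n ⟨chiDot ν (idx n) I, h⟩) : MvPowerSeries ℕ ℂ) =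
      L (comp n I)

end QSymCat

end

open QSymCat

namespace QSymCat

/-! ## Compositions and subsets -/

/-! The whole theorem rests on a factorization. Let `θ` take the value `1` at the identity and
`-1/(ν-1)` elsewhere on `C_ν`. Summing the characters of a block one component at a time gives
`χ̇^I(g) = ∏ θ(g_s)`, the product being over the indices `s` outside `I` (`chi_apply`,
`chiDot_eq_chiProd`). As `θ(1) = 1`, restriction to a subgroup simply deletes factors, tensor
products multiply them, and `ι_S^*` relabels them.

Hence `𝐦_A(χ̇^I, χ̇^J)` is a single normalized supercharacter. Its index is the descent set of the
shuffle of two words with descent sets `I` and `J`, the second with the larger letters and put at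
the positions in `A` (`mA_chiProd`). Likewise `▲_k` cuts `I` at `k` and forgets `k` itself
(`coproductComponent_chiProd`). The same two rules hold for fundamental quasisymmetric functions:
`Lset_mul` counts merges of weakly increasing sequences, and `comul_fundamentalAlg` compares
coefficients.

On the quasisymmetric side, the coefficients of `M_α` and `L_α` depend only on the ordered list of
nonzero exponents (`exists_eq_mon`, `M_apply_mon`, `Lset_apply_mon`). This makes the `L` a basis.
The coproduct amounts to splitting the alphabet into two consecutive pieces (`coeffTensor_comul`),
which makes it multiplicative. The antipode comes from recursion on length.

Finally, the `χ̇^I` form a basis of the superfunctions: they span because interpolation in `θ`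
produces the superclass indicators (`indicator_apply`), and their number is the dimension
(`finrank_scf`). Matching the bases defines `ch_ν`, and the Hopf structure of `QSym` is transported
along it. Checking the product and the coproduct on basis elements identifies the result with `𝐦`
and `▲`. -/

@[simp] theorem Comp.size_nil : Comp.size [] = 0 := rfl

@[simp] theorem Comp.size_cons (a : ℕ+) (α : Comp) : Comp.size (a :: α) = a + Comp.size α := rfl

@[simp] theorem Comp.size_append (α β : Comp) :
    Comp.size (α ++ β) = Comp.size α + Comp.size β := by
  simp [Comp.size]

theorem Comp.size_take_lt (α : Comp) (k : ℕ) (hk : k < α.length) :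
    Comp.size (α.take k) < Comp.size α := by
  induction α generalizing k with
  | nil => simp at hk
  | cons a α ih =>
    cases k with
    | zero => simp
    | succ k =>
      have := ih k (by simpa using hk)
      simpa using this

/-- The index `k` may be left unbounded because `take` saturates: the two inequalities exclude `k =
0` and every `k ≥ α.length`. -/
theorem Comp.mem_set {α : Comp} {p : ℕ} :
    p ∈ Comp.set α ↔ 0 < p ∧ p < Comp.size α ∧ ∃ k, Comp.size (α.take k) = p := by
  simp only [Comp.set, Finset.mem_image, Finset.mem_Ico]
  constructor
  · rintro ⟨i, ⟨h1, h2⟩, rfl⟩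
    refine ⟨?_, Comp.size_take_lt α i h2, i, rfl⟩
    obtain ⟨j, rfl⟩ := Nat.exists_eq_add_of_le' h1
    cases α with
    | nil => simp at h2
    | cons a α => simp
  · rintro ⟨h0, h1, k, rfl⟩
    refine ⟨k, ⟨?_, ?_⟩, rfl⟩
    · by_contra h
      obtain rfl : k = 0 := by omega
      simp at h0
    · by_contra h
      rw [List.take_of_length_le (by omega)] at h1
      omega

theorem Comp.set_subset_idx (α : Comp) : Comp.set α ⊆ idx (Comp.size α) := by
  intro p hp
  obtain ⟨h0, h1, -⟩ := Comp.mem_set.1 hp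
  exact Finset.mem_Icc.2 (by omega)

theorem Comp.add_mem_set_cons {a : ℕ+} {α : Comp} {p : ℕ} (hp : 0 < p) :
    (a : ℕ) + p ∈ Comp.set (a :: α) ↔ p ∈ Comp.set α := by
  simp only [Comp.mem_set, Comp.size_cons]
  constructor
  · rintro ⟨-, h, k, hk⟩
    refine ⟨hp, by omega, ?_⟩
    cases k with
    | zero => simp at hk; omega
    | succ k => exact ⟨k, by simpa using hk⟩
  · rintro ⟨-, h, k, hk⟩
    exact ⟨by omega, by omega, k + 1, by simpa using hk⟩

theorem Comp.le_of_mem_set_cons {a : ℕ+} {α : Comp} {p : ℕ} (hp : p ∈ Comp.set (a :: α)) :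
    (a : ℕ) ≤ p := by
  obtain ⟨h0, -, k, hk⟩ := Comp.mem_set.1 hp
  cases k with
  | zero => simp at hk; omega
  | succ k => simp at hk; omega

theorem Comp.head_mem_set_cons {a : ℕ+} {α : Comp} :
    (a : ℕ) ∈ Comp.set (a :: α) ↔ α ≠ [] := by
  rw [Comp.mem_set]
  cases α with
  | nil => simp
  | cons b α => have := b.pos; simp; exact ⟨1, by simp⟩

/-- The first part of a composition with at least two parts is the minimum of its set, and an empty
set means at most one part. So the set and the size determine the first part, and deleting it shifts
the remaining partial sums. -/
theorem Comp.set_injective {α β : Comp} (h : Comp.size α = Comp.size β)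
    (h' : Comp.set α = Comp.set β) : α = β := by
  induction α generalizing β with
  | nil =>
    cases β with
    | nil => rfl
    | cons b β => have := b.pos; simp at h; omega
  | cons a α ih =>
    cases β with
    | nil => have := a.pos; simp at h
    | cons b β =>
      have hab : a = b := by
        apply PNat.coe_injective
        by_cases hα : α = []
        · by_cases hβ : β = []
          · subst hα hβ
            simpa using h
          · have := (Comp.head_mem_set_cons (a := b)).2 hβ
            rw [← h', hα] at this
            simp [Comp.set] at this
        · by_cases hβ : β = []
          · have := (Comp.head_mem_set_cons (a := a)).2 hα
            rw [h', hβ] at this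
            simp [Comp.set] at this
          · apply le_antisymm
            · apply Comp.le_of_mem_set_cons
              rw [h']
              exact Comp.head_mem_set_cons.2 hβ
            · apply Comp.le_of_mem_set_cons
              rw [← h']
              exact Comp.head_mem_set_cons.2 hα
      subst hab
      rw [ih (by simpa using h)]
      ext p
      by_cases hp : 0 < p
      · rw [← Comp.add_mem_set_cons hp (a := a), h', Comp.add_mem_set_cons hp]
      · simp [Comp.mem_set, hp]

theorem size_zipWith_sub (n s : ℕ) (l : List ℕ) (hl : (s :: l).Pairwise (· < ·))
    (hn : ∀ x ∈ s :: l, x < n) :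
    Comp.size (List.zipWith (fun a b => (b - a).toPNat') (s :: l) (l ++ [n])) = n - s := by
  induction l generalizing s with
  | nil =>
    have := hn s (by simp)
    simp [Nat.toPNat'_coe, this]
  | cons x l ih =>
    have h1 : s < x := List.rel_of_pairwise_cons hl (by simp)
    have h2 := hn x (by simp)
    have := ih x hl.of_cons (fun y hy => hn y (List.mem_cons_of_mem _ hy))
    rw [List.cons_append, List.zipWith_cons_cons, Comp.size_cons, this]
    simp [Nat.toPNat'_coe, h1]
    omega

/-- The differences telescope. The free starting value `s` replaces the initial `0` of `comp` so
that the induction can pass to the tail. -/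
theorem mem_set_zipWith_sub (n s p : ℕ) (l : List ℕ) (hl : (s :: l).Pairwise (· < ·))
    (hn : ∀ x ∈ s :: l, x < n) :
    p ∈ Comp.set (List.zipWith (fun a b => (b - a).toPNat') (s :: l) (l ++ [n])) ↔ s + p ∈ l := by
  induction l generalizing s p with
  | nil => simp [Comp.set]
  | cons x l ih =>
    have h1 : s < x := List.rel_of_pairwise_cons hl (by simp)
    have hx : ((x - s).toPNat' : ℕ) = x - s := by simp [Nat.toPNat'_coe, h1]
    have ih := ih x (p - (x - s)) hl.of_cons (fun y hy => hn y (List.mem_cons_of_mem _ hy))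
    have hgt : ∀ y ∈ l, x < y := fun _ => List.rel_of_pairwise_cons hl.of_cons
    rw [List.cons_append, List.zipWith_cons_cons]
    rcases lt_trichotomy p (x - s) with h | h | h
    · constructor
      · intro hp
        have := Comp.le_of_mem_set_cons hp
        omega
      · intro hp
        rcases List.mem_cons.1 hp with hp | hp
        · omega
        · have := hgt _ hp
          omega
    · have : s + p = x := by omega
      generalize (x - s).toPNat' = a at hx ⊢
      rw [this, h, ← hx, Comp.head_mem_set_cons]
      simp
    · have e1 : p = ((x - s).toPNat' : ℕ) + (p - (x - s)) := by omega
      have e2 : s + p = x + (p - (x - s)) := by omega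
      rw [e2, List.mem_cons, ← ih]
      conv_lhs => rw [e1]
      rw [Comp.add_mem_set_cons (by omega)]
      constructor
      · exact Or.inr
      · rintro (h | h)
        · omega
        · exact h

theorem size_comp {n : ℕ} {I : Finset ℕ} (hI : I ⊆ idx n) : Comp.size (comp n I) = n := by
  unfold comp
  split_ifs with hn
  · simp [hn]
  · rw [size_zipWith_sub, Nat.sub_zero]
    · refine List.pairwise_cons.2 ⟨fun x hx => ?_, ?_⟩
      · have := Finset.mem_Icc.1 (hI ((Finset.mem_sort _).1 hx))
        omega
      · exact I.sortedLT_sort.pairwise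
    · intro x hx
      rcases List.mem_cons.1 hx with rfl | hx
      · omega
      · have := Finset.mem_Icc.1 (hI ((Finset.mem_sort _).1 hx))
        omega

theorem set_comp {n : ℕ} {I : Finset ℕ} (hI : I ⊆ idx n) : Comp.set (comp n I) = I := by
  unfold comp
  split_ifs with hn
  · subst hn
    rw [Finset.subset_empty.1 hI]
    rfl
  · ext p
    rw [mem_set_zipWith_sub]
    · simp
    · refine List.pairwise_cons.2 ⟨fun x hx => ?_, ?_⟩
      · have := Finset.mem_Icc.1 (hI ((Finset.mem_sort _).1 hx))
        omega
      · exact I.sortedLT_sort.pairwise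
    · intro x hx
      rcases List.mem_cons.1 hx with rfl | hx
      · omega
      · have := Finset.mem_Icc.1 (hI ((Finset.mem_sort _).1 hx))
        omega

theorem comp_size_set (α : Comp) : comp (Comp.size α) (Comp.set α) = α :=
  Comp.set_injective (size_comp (Comp.set_subset_idx α)) (set_comp (Comp.set_subset_idx α))

theorem comp_eq_iff {n : ℕ} {I : Finset ℕ} (hI : I ⊆ idx n) (α : Comp) :
    comp n I = α ↔ n = Comp.size α ∧ I = Comp.set α := by
  constructor
  · rintro rfl
    exact ⟨(size_comp hI).symm, (set_comp hI).symm⟩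
  · rintro ⟨rfl, rfl⟩
    exact comp_size_set α

/-! ## Monomials -/

/-- The monomial `x_{i 0} ^ α_1 x_{i 1} ^ α_2 ⋯`. -/
noncomputable def mon (α : Comp) (i : ℕ → ℕ) : ℕ →₀ ℕ :=
  ∑ j : Fin α.length, Finsupp.single (i j) (α.get j : ℕ)

@[simp] theorem mon_nil (i : ℕ → ℕ) : mon [] i = 0 := rfl

theorem mon_cons (a : ℕ+) (α : Comp) (i : ℕ → ℕ) :
    mon (a :: α) i = Finsupp.single (i 0) (a : ℕ) + mon α (fun j => i (j + 1)) := by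
  unfold mon
  exact Fin.sum_univ_succ (n := α.length)
    fun j => Finsupp.single (i j) (((a :: α).get j : ℕ+) : ℕ)

theorem mon_append (α β : Comp) (i : ℕ → ℕ) :
    mon (α ++ β) i = mon α i + mon β (fun j => i (α.length + j)) := by
  induction α generalizing i with
  | nil => simp
  | cons a α ih =>
    rw [List.cons_append, mon_cons, mon_cons, ih, add_assoc]
    congr 3
    funext j
    congr 1
    simp only [List.length_cons]
    omega

theorem mon_congr {α : Comp} {i i' : ℕ → ℕ} (h : ∀ j < α.length, i j = i' j) :
    mon α i = mon α i' :=
  Finset.sum_congr rfl fun j _ => by rw [h j j.2]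

theorem mapDomain_mon (α : Comp) (i f : ℕ → ℕ) :
    Finsupp.mapDomain f (mon α i) = mon α (f ∘ i) := by
  unfold mon
  simp [Finsupp.mapDomain_finsetSum, Finsupp.mapDomain_single]

theorem exists_strictMono_extension {l : ℕ} (i : Fin l → ℕ) (hi : StrictMono i) :
    ∃ σ : ℕ → ℕ, StrictMono σ ∧ ∀ j : Fin l, σ j = i j := by
  -- Beyond `l` the added constant exceeds every value of `i`, so the extension jumps past all of
  -- them.
  refine ⟨fun x => if h : x < l then i ⟨x, h⟩ else x + (∑ j, i j + 1), ?_, ?_⟩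
  · intro x y hxy
    dsimp only
    split_ifs with hx hy hy
    · exact hi hxy
    · have := Finset.single_le_sum (f := i) (fun _ _ => Nat.zero_le _)
        (Finset.mem_univ ⟨x, hx⟩)
      omega
    · omega
    · omega
  · intro j
    simp

/-- An exponent vector is the list of its nonzero exponents together with their increasing
positions. Identities of quasisymmetric series therefore need checking only at vectors `mon α σ`. -/
theorem exists_eq_mon (d : ℕ →₀ ℕ) : ∃ (α : Comp) (σ : ℕ → ℕ), StrictMono σ ∧ d = mon α σ := by
  let e := d.support.orderEmbOfFin rfl
  let α : Comp := List.ofFn fun j => ⟨d (e j),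
    Nat.pos_of_ne_zero (Finsupp.mem_support_iff.1 (Finset.orderEmbOfFin_mem _ _ j))⟩
  have hα : α.length = d.support.card := List.length_ofFn
  obtain ⟨σ, hσ, h⟩ := exists_strictMono_extension e e.strictMono
  refine ⟨α, σ, hσ, ?_⟩
  have h1 : mon α σ = ∑ j : Fin d.support.card, Finsupp.single (σ j) (d (e j)) := by
    unfold mon
    apply Fintype.sum_equiv (finCongr hα)
    intro j
    congr 1
    exact congrArg PNat.val (List.get_ofFn _ j)
  rw [h1]
  conv_lhs => rw [← Finsupp.sum_single d, Finsupp.sum, ← Finset.map_orderEmbOfFin_univ d.support rfl]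
  rw [Finset.sum_map]
  exact Finset.sum_congr rfl fun j _ => by rw [h]; rfl

/-- This is quasisymmetry: relabelling variables by an increasing `σ` is a bijection between the
contributing sequences, since a sequence contributing to `mon α σ` can only take values in the range
of `σ`. That reduces the count to packed monomials. -/
theorem M_apply_mon (β α : Comp) {σ : ℕ → ℕ} (hσ : StrictMono σ) :
    M β (mon α σ) = if β = α then 1 else 0 := by
  rw [← M_apply_packed]
  unfold M
  congr 1
  have hinj : Function.Injective (Finsupp.mapDomain σ : (ℕ →₀ ℕ) → ℕ →₀ ℕ) :=
    Finsupp.mapDomain_injective hσ.injective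
  have hmap : ∀ i : Fin β.length → ℕ,
      Finsupp.mapDomain σ (∑ j, Finsupp.single (i j) (β.get j : ℕ)) =
        ∑ j, Finsupp.single (σ (i j)) (β.get j : ℕ) := by
    intro i
    simp [Finsupp.mapDomain_finsetSum, Finsupp.mapDomain_single]
  have hα : mon α σ = Finsupp.mapDomain σ
      (∑ j : Fin α.length, Finsupp.single (j : ℕ) (α.get j : ℕ)) := by
    simp [mon, Finsupp.mapDomain_finsetSum, Finsupp.mapDomain_single]
  symm
  refine Nat.card_congr (Equiv.ofBijective (fun i => ⟨fun j => σ (i.1 j),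
    fun a b hab => hσ (i.2.1 hab), by rw [← hmap, i.2.2, hα]⟩) ⟨?_, ?_⟩)
  · intro i i' h
    apply Subtype.ext
    funext j
    exact hσ.injective (congrFun (congrArg Subtype.val h) j)
  · rintro ⟨i, hi, h⟩
    have hr : ∀ j, ∃ x, σ x = i j := by
      intro j
      by_contra hx
      have h1 : (∑ j, Finsupp.single (i j) (β.get j : ℕ)) (i j) = 0 := by
        rw [h, hα]
        exact Finsupp.mapDomain_of_notMem_range _ _ (by simpa using hx)
      rw [Finsupp.finsetSum_apply, Finset.sum_eq_zero_iff] at h1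
      have := h1 j (Finset.mem_univ j)
      simp at this
    choose i' hi' using hr
    refine ⟨⟨i', fun a b hab => hσ.lt_iff_lt.1 (by rw [hi', hi']; exact hi hab), ?_⟩, ?_⟩
    · apply hinj
      rw [hmap, ← hα, ← h]
      simp only [hi']
    · apply Subtype.ext
      funext j
      exact hi' j

/-! ## Fundamental quasisymmetric functions indexed by sets -/

/-- The fundamental quasisymmetric function `L_{comp(I)}` of degree `n`. -/
noncomputable def Lset (n : ℕ) (I : Finset ℕ) : MvPowerSeries ℕ ℂ := fun d =>
  (Nat.card {i : Fin n → ℕ //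
    Monotone i ∧ (∀ a b : Fin n, (b : ℕ) = a + 1 → (b : ℕ) ∈ I → i a < i b) ∧
      ∑ j, Finsupp.single (i j) 1 = d} : ℂ)

theorem L_eq_Lset (α : Comp) : L α = Lset α.size α.set := rfl

theorem L_comp {n : ℕ} {I : Finset ℕ} (hI : I ⊆ idx n) : L (comp n I) = Lset n I := by
  rw [L_eq_Lset, size_comp hI, set_comp hI]

/-! ### Coefficients of fundamental functions through partial sums of exponents -/

/-- The partial sums of an exponent vector. -/
def psum (d : ℕ →₀ ℕ) (x : ℕ) : ℕ := ∑ y ∈ Finset.range x, d y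

theorem psum_add (d e : ℕ →₀ ℕ) (x : ℕ) : psum (d + e) x = psum d x + psum e x := by
  simp [psum, Finset.sum_add_distrib]

theorem psum_single (a b x : ℕ) : psum (Finsupp.single a b) x = if a < x then b else 0 := by
  simp [psum, Finsupp.single_apply]

theorem psum_succ (d : ℕ →₀ ℕ) (x : ℕ) : psum d (x + 1) = psum d x + d x :=
  Finset.sum_range_succ _ _

theorem psum_mono (d : ℕ →₀ ℕ) : Monotone (psum d) :=
  monotone_nat_of_le_succ fun x => by rw [psum_succ]; omega

theorem psum_sum_single {n : ℕ} (i : Fin n → ℕ) (x : ℕ) :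
    psum (∑ j, Finsupp.single (i j) 1) x = (Finset.univ.filter fun j => i j < x).card := by
  simp only [psum, Finsupp.finsetSum_apply, Finset.card_filter]
  rw [Finset.sum_comm]
  refine Finset.sum_congr rfl fun j _ => ?_
  simp [Finsupp.single_apply]

theorem psum_mon {α : Comp} {σ : ℕ → ℕ} {x k : ℕ} (h : ∀ j, σ j < x ↔ j < k) :
    psum (mon α σ) x = Comp.size (α.take k) := by
  induction α generalizing σ k with
  | nil => simp [psum]
  | cons a α ih =>
    rw [mon_cons, psum_add, psum_single]
    cases k with
    | zero =>
      rw [ih (k := 0) (fun j => by simpa using h (j + 1))]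
      simp [h]
    | succ k =>
      rw [ih (k := k) (fun j => by simpa using h (j + 1))]
      simp [h]

theorem exists_lt_iff_lt {σ : ℕ → ℕ} (hσ : StrictMono σ) (x : ℕ) :
    ∃ k, ∀ j, σ j < x ↔ j < k := by
  classical
  have hx : ∃ k, x ≤ σ k := ⟨x, hσ.le_apply⟩
  refine ⟨Nat.find hx, fun j => ?_⟩
  rw [Nat.lt_find_iff]
  constructor
  · intro h m hm
    have := hσ.monotone hm
    omega
  · intro h
    have := h j le_rfl
    omega

/-- The variables below `x` carry an initial segment of the parts of `α`, and every initial segment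
occurs for some `x`. -/
theorem exists_psum_mon_iff {α : Comp} {σ : ℕ → ℕ} (hσ : StrictMono σ) (p : ℕ) :
    (∃ x, psum (mon α σ) x = p) ↔ ∃ k, Comp.size (α.take k) = p := by
  constructor
  · rintro ⟨x, rfl⟩
    obtain ⟨k, hk⟩ := exists_lt_iff_lt hσ x
    exact ⟨k, (psum_mon hk).symm⟩
  · rintro ⟨k, rfl⟩
    exact ⟨σ k, psum_mon fun j => hσ.lt_iff_lt⟩

theorem degree_mon (α : Comp) (σ : ℕ → ℕ) : (mon α σ).degree = Comp.size α := by
  induction α generalizing σ with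
  | nil => simp
  | cons a α ih => rw [mon_cons, map_add, ih, Finsupp.degree_single, Comp.size_cons]

/-- The positions holding values below `x` form an initial segment of length `psum d x`. In
particular a monotone sequence is determined by its content `d`. -/
theorem lt_iff_lt_psum {n : ℕ} {i : Fin n → ℕ} (hi : Monotone i) {d : ℕ →₀ ℕ}
    (h : ∑ j, Finsupp.single (i j) 1 = d) (p : Fin n) (x : ℕ) : i p < x ↔ (p : ℕ) < psum d x := by
  rw [← h, psum_sum_single]
  constructor
  · intro hp
    have : (Finset.Iic p) ⊆ Finset.univ.filter fun j => i j < x := by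
      intro j hj
      simp only [Finset.mem_filter, Finset.mem_univ, true_and]
      exact lt_of_le_of_lt (hi (Finset.mem_Iic.1 hj)) hp
    have := Finset.card_le_card this
    rw [Fin.card_Iic] at this
    omega
  · intro hp
    by_contra hx
    have : (Finset.univ.filter fun j => i j < x) ⊆ Finset.Iio p := by
      intro j hj
      simp only [Finset.mem_filter, Finset.mem_univ, true_and] at hj
      rw [Finset.mem_Iio]
      by_contra hjp
      have := hi (not_lt.1 hjp)
      omega
    have := Finset.card_le_card this
    rw [Fin.card_Iio] at this
    omega

theorem exists_psum_eq_degree (d : ℕ →₀ ℕ) : ∃ x, ∀ y, x ≤ y → psum d y = d.degree := by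
  refine ⟨d.support.sup id + 1, fun y hy => ?_⟩
  rw [psum, Finsupp.degree_apply]
  symm
  refine Finset.sum_subset ?_ fun z _ hz => Finsupp.notMem_support_iff.1 hz
  intro z hz
  have := Finset.le_sup (f := id) hz
  simp only [id] at this
  exact Finset.mem_range.2 (by omega)

/-- A vector of degree `n` has exactly one weakly increasing arrangement, so the coefficient is `0`
or `1`. The arrangement jumps after its `p`-th entry exactly when some initial block of values has
`p` entries in all, that is, when `p` is a partial sum. -/
theorem Lset_apply {n : ℕ} {I : Finset ℕ} (hI : I ⊆ idx n) (d : ℕ →₀ ℕ) [Decidable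
    (d.degree = n ∧ ∀ p ∈ I, ∃ x, psum d x = p)] :
    Lset n I d = if d.degree = n ∧ ∀ p ∈ I, ∃ x, psum d x = p then 1 else 0 := by
  classical
  unfold Lset
  split_ifs with hd
  · obtain ⟨hd, hp⟩ := hd
    obtain ⟨X, hX⟩ := exists_psum_eq_degree d
    have hex : ∀ p : Fin n, ∃ x, (p : ℕ) < psum d (x + 1) := fun p =>
      ⟨X, by rw [hX _ (by omega), hd]; exact p.2⟩
    -- The entry at `p` is the first value whose cumulative multiplicity exceeds `p`.
    let i : Fin n → ℕ := fun p => Nat.find (hex p)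
    have hi : ∀ p x, i p < x ↔ (p : ℕ) < psum d x := by
      intro p x
      constructor
      · intro h
        exact (Nat.find_spec (hex p)).trans_le (psum_mono d h)
      · intro h
        cases x with
        | zero => simp [psum] at h
        | succ x => exact Nat.lt_succ_of_le (Nat.find_min' (hex p) h)
    have hmono : Monotone i := by
      intro p q hpq
      by_contra hlt
      have := (hi q (i p)).1 (not_le.1 hlt)
      have h2 := (hi p (i p)).2 (lt_of_le_of_lt hpq this)
      omega
    have hcard : Nat.card {i : Fin n → ℕ //
        Monotone i ∧ (∀ a b : Fin n, (b : ℕ) = a + 1 → (b : ℕ) ∈ I → i a < i b) ∧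
          ∑ j, Finsupp.single (i j) 1 = d} = 1 := by
      rw [Nat.card_eq_one_iff_unique]
      refine ⟨⟨?_⟩, ⟨⟨i, hmono, ?_, ?_⟩⟩⟩
      · rintro ⟨u, hu, -, hu'⟩ ⟨v, hv, -, hv'⟩
        apply Subtype.ext
        funext p
        apply le_antisymm
        · by_contra h
          have := (lt_iff_lt_psum hv hv' p (u p)).1 (not_le.1 h)
          rw [← lt_iff_lt_psum hu hu'] at this
          omega
        · by_contra h
          have := (lt_iff_lt_psum hu hu' p (v p)).1 (not_le.1 h)
          rw [← lt_iff_lt_psum hv hv'] at this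
          omega
      · intro a b hab hb
        obtain ⟨x, hx⟩ := hp _ hb
        have h1 := (hi a x).2 (by omega)
        have h2 := (hi b x).not.2 (by omega)
        omega
      · have hps : ∀ x, psum (∑ j, Finsupp.single (i j) 1) x = psum d x := by
          intro x
          rw [psum_sum_single]
          simp only [hi]
          have hle : psum d x ≤ n := by
            rw [← hd, ← hX (X + x) (by omega)]
            exact psum_mono d (by omega)
          rw [Fin.card_filter_val_lt]
          omega
        ext x
        have h1 := hps (x + 1)
        rw [psum_succ, psum_succ, hps] at h1
        omega
    rw [hcard, Nat.cast_one]
  · rw [Nat.cast_eq_zero, Nat.card_eq_zero]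
    left
    constructor
    rintro ⟨i, hi, hs, h⟩
    apply hd
    have hdeg : d.degree = n := by
      rw [← h, map_sum]
      simp
    refine ⟨hdeg, fun p hp => ?_⟩
    have hp' := Finset.mem_Icc.1 (hI hp)
    -- A member `p` of `I` separates the zero-based positions `p - 1` and `p`.
    have hlt := hs ⟨p - 1, by omega⟩ ⟨p, by omega⟩ (by simp; omega) hp
    refine ⟨i ⟨p, by omega⟩, ?_⟩
    have h1 := (lt_iff_lt_psum hi h _ _).1 hlt
    have h2 := (lt_iff_lt_psum hi h ⟨p, by omega⟩ (i ⟨p, by omega⟩)).not.1 (lt_irrefl _)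
    simp only at h1 h2
    omega

theorem Lset_apply_mon {n : ℕ} {I : Finset ℕ} (hI : I ⊆ idx n) (α : Comp) {σ : ℕ → ℕ}
    (hσ : StrictMono σ) :
    Lset n I (mon α σ) = if Comp.size α = n ∧ I ⊆ Comp.set α then 1 else 0 := by
  classical
  rw [Lset_apply hI]
  refine if_congr ?_ rfl rfl
  rw [degree_mon]
  refine and_congr_right fun h => forall₂_congr fun p hp => ?_
  rw [exists_psum_mon_iff hσ, Comp.mem_set]
  have := Finset.mem_Icc.1 (hI hp)
  constructor
  · exact fun hk => ⟨by omega, by omega, hk⟩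
  · exact fun hk => hk.2.2

end QSymCat

namespace QSymCat

/-! ## The basis of fundamental quasisymmetric functions -/

@[simp] theorem coe_basisM (α : Comp) : (basisM α : MvPowerSeries ℕ ℂ) = M α :=
  congrArg Subtype.val (Module.Basis.span_apply linearIndependent_M α)

/-- The coefficient functional at `x_0 ^ α_1 x_1 ^ α_2 ⋯`. -/
noncomputable def coeffQSym (α : Comp) : QSym →ₗ[ℂ] ℂ where
  toFun f := (f : MvPowerSeries ℕ ℂ) (mon α id)
  map_add' _ _ := rfl
  map_smul' _ _ := rfl

/-- At `mon α σ` the only term that can contribute is the one with `J = set(α)`. -/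
theorem Lset_eq_sum {n : ℕ} {I : Finset ℕ} (hI : I ⊆ idx n) :
    Lset n I = ∑ J ∈ (idx n).powerset with I ⊆ J, M (comp n J) := by
  classical
  funext d
  obtain ⟨α, σ, hσ, rfl⟩ := exists_eq_mon d
  rw [Lset_apply_mon hI α hσ]
  refine Eq.trans ?_ (Finset.sum_apply (mon α σ) _ fun J => M (comp n J)).symm
  simp only [M_apply_mon _ α hσ]
  split_ifs with h
  · obtain ⟨rfl, h⟩ := h
    rw [Finset.sum_eq_single (Comp.set α)]
    · rw [if_pos (comp_size_set α)]
    · intro J hJ hne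
      rw [if_neg]
      rw [comp_eq_iff (Finset.mem_powerset.1 (Finset.mem_filter.1 hJ).1)]
      exact fun h => hne h.2
    · intro h'
      exact absurd (Finset.mem_filter.2
        ⟨Finset.mem_powerset.2 (Comp.set_subset_idx α), h⟩) h'
  · symm
    apply Finset.sum_eq_zero
    intro J hJ
    rw [Finset.mem_filter, Finset.mem_powerset] at hJ
    rw [if_neg]
    rw [comp_eq_iff hJ.1]
    rintro ⟨rfl, rfl⟩
    exact h ⟨rfl, hJ.2⟩

theorem M_mem_QSym (α : Comp) : M α ∈ QSym := Submodule.subset_span ⟨α, rfl⟩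

theorem Lset_mem_QSym {n : ℕ} {I : Finset ℕ} (hI : I ⊆ idx n) : Lset n I ∈ QSym := by
  rw [Lset_eq_sum hI]
  exact Submodule.sum_mem _ fun J _ => M_mem_QSym _

/-- The index set of the bases: pairs of a degree `n` and a subset of `[n - 1]`. -/
abbrev SetIndex : Type := Σ n : ℕ, (idx n).powerset

theorem SetIndex.subset (x : SetIndex) : (x.2 : Finset ℕ) ⊆ idx x.1 := Finset.mem_powerset.1 x.2.2

/-- The fundamental quasisymmetric functions as elements of `QSym`. -/
noncomputable def fundamental (x : SetIndex) : QSym := ⟨Lset x.1 x.2, Lset_mem_QSym x.subset⟩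

theorem fundamental_apply (x y : SetIndex) :
    coeffQSym (comp x.1 x.2) (fundamental y) =
      if x.1 = y.1 ∧ (y.2 : Finset ℕ) ⊆ x.2 then 1 else 0 := by
  refine (Lset_apply_mon y.subset _ strictMono_id).trans ?_
  rw [size_comp x.subset, set_comp x.subset]

/-- The matrix of coefficients at packed monomials is unitriangular for inclusion of sets:
evaluation at `comp(I)` sees only the `L` of subsets of `I`. Induction on the cardinality then
removes the coefficients one by one. -/
theorem linearIndependent_fundamental : LinearIndependent ℂ fundamental := by
  classical
  rw [linearIndependent_iff']
  intro s c h
  have key : ∀ k, ∀ x ∈ s, (x.2 : Finset ℕ).card = k → c x = 0 := by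
    intro k
    induction k using Nat.strong_induction_on with
    | _ k ih =>
      intro x hx hk
      have h1 := congrArg (coeffQSym (comp x.1 x.2)) h
      rw [map_sum, map_zero, Finset.sum_eq_single x] at h1
      · simpa [fundamental_apply] using h1
      · intro y hy hne
        rw [map_smul, fundamental_apply]
        split_ifs with hxy
        · rw [ih _ ?_ y hy rfl, zero_smul]
          rw [← hk]
          refine Finset.card_lt_card (Finset.ssubset_iff_subset_ne.2 ⟨hxy.2, fun he => hne ?_⟩)
          obtain ⟨n, I⟩ := x
          obtain ⟨m, J⟩ := y
          obtain ⟨rfl, -⟩ := hxy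
          simp only at he
          rw [Subtype.ext he]
        · exact smul_zero _
      · exact fun h => absurd hx h
  exact fun x hx => key _ x hx rfl

theorem span_fundamental : ⊤ ≤ Submodule.span ℂ (Set.range fundamental) := by
  classical
  rw [← basisM.span_eq, Submodule.span_le]
  rintro _ ⟨α, rfl⟩
  -- The triangular system is solved from the largest sets downwards, so the induction is on the
  -- number of missing elements.
  have key : ∀ k n, ∀ I ⊆ idx n, (idx n).card - I.card = k →
      basisM (comp n I) ∈ Submodule.span ℂ (Set.range fundamental) := by
    intro k
    induction k using Nat.strong_induction_on with
    | _ k ih =>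
      intro n I hI hk
      have h : fundamental ⟨n, I, Finset.mem_powerset.2 hI⟩ =
          ∑ J ∈ (idx n).powerset with I ⊆ J, basisM (comp n J) := by
        apply Subtype.ext
        simp only [fundamental, Lset_eq_sum hI, Submodule.coe_sum, coe_basisM]
      have hmem : I ∈ (idx n).powerset.filter (I ⊆ ·) := by simp [hI]
      rw [← Finset.add_sum_erase _ _ hmem] at h
      rw [← sub_eq_iff_eq_add.2 h]
      refine Submodule.sub_mem _ (Submodule.subset_span ⟨_, rfl⟩) (Submodule.sum_mem _ ?_)
      intro J hJ
      rw [Finset.mem_erase, Finset.mem_filter, Finset.mem_powerset] at hJ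
      refine ih _ ?_ n J hJ.2.1 rfl
      have h1 := Finset.card_lt_card (Finset.ssubset_iff_subset_ne.2 ⟨hJ.2.2, hJ.1.symm⟩)
      have h2 := Finset.card_le_card hJ.2.1
      omega
  have := key _ _ _ (Comp.set_subset_idx α) rfl
  rwa [comp_size_set] at this

/-- The basis of fundamental quasisymmetric functions. -/
noncomputable def basisL : Module.Basis SetIndex ℂ QSym :=
  Module.Basis.mk linearIndependent_fundamental span_fundamental

@[simp] theorem basisL_apply (x : SetIndex) : basisL x = fundamental x :=
  Module.Basis.mk_apply _ _ x

end QSymCat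

namespace QSymCat

/-! ## Shuffles -/

/-- The sequences `i` contributing to the fundamental quasisymmetric function `L_{comp(I)}`. -/
def Admissible (n : ℕ) (I : Finset ℕ) (i : Fin n → ℕ) : Prop :=
  Monotone i ∧ ∀ a b : Fin n, (b : ℕ) = a + 1 → (b : ℕ) ∈ I → i a < i b

/-- The number of elements of `A` that are at most `p`. -/
def rankIn (A : Finset ℕ) (p : ℕ) : ℕ := (A.filter (· ≤ p)).card

/-- The descent set of the shuffle of two words with descent sets `I` and `J`, the letters of the
second word being larger and put at the positions in `A`. -/
def shuffleDescents (N : ℕ) (A I J : Finset ℕ) : Finset ℕ :=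
  (Finset.Icc 1 (N - 1)).filter fun p =>
    if p ∈ A then (p + 1 ∈ A → rankIn A p ∈ J)
    else (p + 1 ∉ A ∧ rankIn (Finset.Icc 1 N \ A) p ∈ I)

theorem shuffleDescents_subset (N : ℕ) (A I J : Finset ℕ) : shuffleDescents N A I J ⊆ idx N :=
  Finset.filter_subset _ _

/-- The increasing sequences `a` and `b` of positions form a shuffle. -/
structure IsShuffle {m n : ℕ} (a : Fin m → Fin (m + n)) (b : Fin n → Fin (m + n)) : Prop where
  left : StrictMono a
  right : StrictMono b
  ne : ∀ s t, a s ≠ b t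

section Shuffle

variable {m n : ℕ} {a a' : Fin m → Fin (m + n)} {b b' : Fin n → Fin (m + n)}

theorem IsShuffle.bijective (h : IsShuffle a b) : Function.Bijective (Sum.elim a b) := by
  rw [Fintype.bijective_iff_injective_and_card]
  refine ⟨h.left.injective.sumElim h.right.injective h.ne, by simp⟩

theorem IsShuffle.cover (h : IsShuffle a b) (p : Fin (m + n)) :
    (∃ s, a s = p) ∨ ∃ t, b t = p := by
  obtain ⟨x | x, hx⟩ := h.bijective.surjective p
  · exact Or.inl ⟨x, hx⟩
  · exact Or.inr ⟨x, hx⟩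

/-- The comparisons between the two words fix the whole order on the disjoint union. The transition
between the two bijections is thus an increasing self-bijection of a finite chain, hence the
identity. -/
theorem IsShuffle.unique (h : IsShuffle a b) (h' : IsShuffle a' b')
    (hlt : ∀ s t, a s < b t ↔ a' s < b' t) : a = a' ∧ b = b' := by
  let E := Equiv.ofBijective _ h.bijective
  let E' := Equiv.ofBijective _ h'.bijective
  have hlt' : ∀ s t, b t < a s ↔ b' t < a' s := by
    intro s t
    have h1 := h.ne s t
    have h2 := h'.ne s t
    have h3 := hlt s t
    rw [← not_iff_not, not_lt, not_lt, le_iff_lt_or_eq, le_iff_lt_or_eq, h3]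
    simp [h1, h2]
  have hE : ∀ x y, E x < E y → E' x < E' y := by
    rintro (x | x) (y | y) hxy
    · exact h'.left (h.left.lt_iff_lt.1 hxy)
    · exact (hlt _ _).1 hxy
    · exact (hlt' _ _).1 hxy
    · exact h'.right (h.right.lt_iff_lt.1 hxy)
  have hf : StrictMono (E' ∘ E.symm) := fun p q hpq => hE _ _ (by simpa using hpq)
  have hid : E' ∘ E.symm = id := by
    apply (hf.range_inj strictMono_id).1
    rw [Set.range_id, (E'.surjective.comp E.symm.surjective).range_eq]
  have hEE : ∀ x, E' x = E x := fun x => by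
    have := congrFun hid (E x)
    simpa using this
  exact ⟨funext fun s => (hEE (Sum.inl s)).symm, funext fun t => (hEE (Sum.inr t)).symm⟩

/-- Stable merging, with ties won by the first word. Each entry is placed at its own index plus the
number of entries of the other word that must precede it. -/
theorem isShuffle_merge (i : Fin m → ℕ) (j : Fin n → ℕ) (hi : Monotone i) (hj : Monotone j) :
    ∃ (a : Fin m → Fin (m + n)) (b : Fin n → Fin (m + n)), IsShuffle a b ∧
      ∀ s t, a s < b t ↔ i s ≤ j t := by
  have ha : ∀ s : Fin m, (s : ℕ) + (Finset.univ.filter fun t => j t < i s).card < m + n := by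
    intro s
    have := Finset.card_le_univ (Finset.univ.filter fun t => j t < i s)
    rw [Fintype.card_fin] at this
    omega
  have hb : ∀ t : Fin n, (t : ℕ) + (Finset.univ.filter fun s => i s ≤ j t).card < m + n := by
    intro t
    have := Finset.card_le_univ (Finset.univ.filter fun s => i s ≤ j t)
    rw [Fintype.card_fin] at this
    omega
  have hlt : ∀ s t, i s ≤ j t →
      (s : ℕ) + (Finset.univ.filter fun t => j t < i s).card <
        (t : ℕ) + (Finset.univ.filter fun s => i s ≤ j t).card := by
    intro s t hst
    have h1 : (Finset.univ.filter fun t' => j t' < i s) ⊆ Finset.Iio t := by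
      intro t' ht'
      simp only [Finset.mem_filter, Finset.mem_univ, true_and] at ht'
      rw [Finset.mem_Iio]
      by_contra hle
      have := hj (not_lt.1 hle)
      omega
    have h2 : Finset.Iic s ⊆ Finset.univ.filter fun s' => i s' ≤ j t := by
      intro s' hs'
      simp only [Finset.mem_filter, Finset.mem_univ, true_and]
      exact (hi (Finset.mem_Iic.1 hs')).trans hst
    have h1 := Finset.card_le_card h1
    have h2 := Finset.card_le_card h2
    rw [Fin.card_Iio] at h1
    rw [Fin.card_Iic] at h2
    omega
  have hgt : ∀ s t, j t < i s →
      (t : ℕ) + (Finset.univ.filter fun s => i s ≤ j t).card <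
        (s : ℕ) + (Finset.univ.filter fun t => j t < i s).card := by
    intro s t hst
    have h1 : (Finset.univ.filter fun s' => i s' ≤ j t) ⊆ Finset.Iio s := by
      intro s' hs'
      simp only [Finset.mem_filter, Finset.mem_univ, true_and] at hs'
      rw [Finset.mem_Iio]
      by_contra hle
      have := hi (not_lt.1 hle)
      omega
    have h2 : Finset.Iic t ⊆ Finset.univ.filter fun t' => j t' < i s := by
      intro t' ht'
      simp only [Finset.mem_filter, Finset.mem_univ, true_and]
      exact (hj (Finset.mem_Iic.1 ht')).trans_lt hst
    have h1 := Finset.card_le_card h1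
    have h2 := Finset.card_le_card h2
    rw [Fin.card_Iio] at h1
    rw [Fin.card_Iic] at h2
    omega
  refine ⟨fun s => ⟨_, ha s⟩, fun t => ⟨_, hb t⟩, ⟨?_, ?_, ?_⟩, ?_⟩
  · intro s s' hs
    have : (Finset.univ.filter fun t => j t < i s) ⊆ Finset.univ.filter fun t => j t < i s' :=
      Finset.monotone_filter_right _ fun t _ ht => lt_of_lt_of_le ht (hi hs.le)
    have := Finset.card_le_card this
    have : (s : ℕ) < s' := hs
    rw [Fin.mk_lt_mk]
    omega
  · intro t t' ht
    have : (Finset.univ.filter fun s => i s ≤ j t) ⊆ Finset.univ.filter fun s => i s ≤ j t' :=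
      Finset.monotone_filter_right _ fun s _ hs => le_trans hs (hj ht.le)
    have := Finset.card_le_card this
    have : (t : ℕ) < t' := ht
    rw [Fin.mk_lt_mk]
    omega
  · intro s t hst
    rw [Fin.mk.injEq] at hst
    rcases le_or_gt (i s) (j t) with h | h
    · have := hlt s t h
      omega
    · have := hgt s t h
      omega
  · intro s t
    rw [Fin.mk_lt_mk]
    refine ⟨fun hst => ?_, hlt s t⟩
    by_contra h
    have := hgt s t (not_le.1 h)
    omega

/-- The set of positions of the second word, counted from `1`. -/
def positions (b : Fin n → Fin (m + n)) : Finset ℕ := Finset.univ.image fun t => (b t : ℕ) + 1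

theorem mem_positions {p : Fin (m + n)} : (p : ℕ) + 1 ∈ positions b ↔ ∃ t, b t = p := by
  simp [positions, Fin.ext_iff]

theorem positions_mem_powersetCard (hb : StrictMono b) :
    positions b ∈ (Finset.Icc 1 (m + n)).powersetCard n := by
  rw [Finset.mem_powersetCard]
  constructor
  · intro p hp
    simp only [positions, Finset.mem_image] at hp
    obtain ⟨t, -, rfl⟩ := hp
    exact Finset.mem_Icc.2 (by omega)
  · rw [positions, Finset.card_image_of_injective, Finset.card_fin]
    intro t t' h
    exact hb.injective (Fin.ext (by simpa using h))

theorem IsShuffle.sdiff_positions (h : IsShuffle a b) :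
    Finset.Icc 1 (m + n) \ positions b = Finset.univ.image fun s => (a s : ℕ) + 1 := by
  ext p
  simp only [Finset.mem_sdiff, Finset.mem_Icc, Finset.mem_image, Finset.mem_univ, true_and]
  constructor
  · rintro ⟨⟨h1, h2⟩, h3⟩
    obtain ⟨q, rfl⟩ := Nat.exists_eq_add_of_le' h1
    rcases h.cover ⟨q, by omega⟩ with ⟨s, hs⟩ | ht
    · exact ⟨s, by rw [hs]⟩
    · exact absurd ((mem_positions (p := ⟨q, by omega⟩)).2 ht) h3
  · rintro ⟨s, rfl⟩
    refine ⟨by omega, ?_⟩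
    rw [mem_positions]
    rintro ⟨t, ht⟩
    exact h.ne s t ht.symm

theorem exists_isShuffle {A : Finset ℕ} (hA : A ∈ (Finset.Icc 1 (m + n)).powersetCard n) :
    ∃ (a : Fin m → Fin (m + n)) (b : Fin n → Fin (m + n)), IsShuffle a b ∧ positions b = A := by
  obtain ⟨hA, hc⟩ := Finset.mem_powersetCard.1 hA
  have hc' : (Finset.Icc 1 (m + n) \ A).card = m := by
    rw [Finset.card_sdiff_of_subset hA, hc, Nat.card_Icc]
    omega
  let e := A.orderEmbOfFin hc
  let e' := (Finset.Icc 1 (m + n) \ A).orderEmbOfFin hc'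
  have he : ∀ t, e t ∈ A := Finset.orderEmbOfFin_mem A hc
  have he' : ∀ s, e' s ∈ Finset.Icc 1 (m + n) \ A := Finset.orderEmbOfFin_mem _ hc'
  have he1 : ∀ t, 1 ≤ e t ∧ e t ≤ m + n := fun t => Finset.mem_Icc.1 (hA (he t))
  have he1' : ∀ s, 1 ≤ e' s ∧ e' s ≤ m + n := fun s =>
    Finset.mem_Icc.1 (Finset.mem_sdiff.1 (he' s)).1
  refine ⟨fun s => ⟨e' s - 1, by have := he1' s; omega⟩,
    fun t => ⟨e t - 1, by have := he1 t; omega⟩, ⟨?_, ?_, ?_⟩, ?_⟩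
  · intro s s' hs
    have := e'.strictMono hs
    have := he1' s
    rw [Fin.mk_lt_mk]
    omega
  · intro s s' hs
    have := e.strictMono hs
    have := he1 s
    rw [Fin.mk_lt_mk]
    omega
  · intro s t hst
    rw [Fin.mk.injEq] at hst
    have h1 := he1' s
    have h2 := he1 t
    have : e' s = e t := by omega
    exact (Finset.mem_sdiff.1 (he' s)).2 (this ▸ he t)
  · have : ∀ t, e t - 1 + 1 = e t := fun t => Nat.sub_add_cancel (he1 t).1
    simp only [positions, this]
    exact Finset.image_orderEmbOfFin_univ A hc

theorem rankIn_image {r : ℕ} {c : Fin r → ℕ} (hc : StrictMono c) (t : Fin r) :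
    rankIn (Finset.univ.image c) (c t) = t + 1 := by
  have : (Finset.univ.image c).filter (· ≤ c t) = (Finset.Iic t).image c := by
    ext p
    simp only [Finset.mem_filter, Finset.mem_image, Finset.mem_univ, true_and, Finset.mem_Iic]
    constructor
    · rintro ⟨⟨t', rfl⟩, h⟩
      exact ⟨t', hc.le_iff_le.1 h, rfl⟩
    · rintro ⟨t', h, rfl⟩
      exact ⟨⟨t', rfl⟩, hc.monotone h⟩
  rw [rankIn, this, Finset.card_image_of_injective _ hc.injective, Fin.card_Iic]

/-- Positions in `Fin` count from `0`, descents from `1`, so the number `q = p + 1` stands for the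
gap between `p` and `q`. Passing from the second word to the first is always a descent, the reverse
never, and inside one word the descent set of that word decides. -/
theorem IsShuffle.mem_shuffleDescents (h : IsShuffle a b) (I J : Finset ℕ) {p q : Fin (m + n)}
    (hpq : (q : ℕ) = p + 1) :
    (∀ s t, b t = p → a s = q → (q : ℕ) ∈ shuffleDescents (m + n) (positions b) I J) ∧
    (∀ s t, a s = p → b t = q → (q : ℕ) ∉ shuffleDescents (m + n) (positions b) I J) ∧
    (∀ s s', a s = p → a s' = q →
      ((q : ℕ) ∈ shuffleDescents (m + n) (positions b) I J ↔ (s : ℕ) + 1 ∈ I)) ∧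
    (∀ t t', b t = p → b t' = q →
      ((q : ℕ) ∈ shuffleDescents (m + n) (positions b) I J ↔ (t : ℕ) + 1 ∈ J)) := by
  have hq : (q : ℕ) ∈ Finset.Icc 1 (m + n - 1) := Finset.mem_Icc.2 (by omega)
  have hb : ∀ t, (b t : ℕ) + 1 ∈ positions b := fun t => mem_positions.2 ⟨t, rfl⟩
  have ha : ∀ s, (a s : ℕ) + 1 ∉ positions b := by
    intro s hs
    obtain ⟨t, ht⟩ := mem_positions.1 hs
    exact h.ne s t ht.symm
  unfold shuffleDescents
  simp only [Finset.mem_filter, hq, true_and]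
  refine ⟨?_, ?_, ?_, ?_⟩
  · rintro s t rfl rfl
    rw [hpq, if_pos (hb t), ← hpq]
    exact fun h => absurd h (ha s)
  · rintro s t rfl rfl
    rw [hpq, if_neg (ha s), ← hpq]
    exact fun h => h.1 (hb t)
  · rintro s s' rfl rfl
    have h1 := ha s'
    rw [hpq] at h1 ⊢
    rw [if_neg (ha s), h.sdiff_positions, rankIn_image fun s s' hs => Nat.succ_lt_succ (h.left hs)]
    exact and_iff_right h1
  · rintro t t' rfl rfl
    have h1 := hb t'
    rw [hpq] at h1 ⊢
    rw [if_pos (hb t), positions, rankIn_image fun t t' ht => Nat.succ_lt_succ (h.right ht)]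
    exact imp_iff_right h1

/-- An admissible sequence on the shuffle is the same as two admissible sequences whose stable merge
is that shuffle. The forced descents from second-word to first-word letters give the strict
inequalities needed for tie-breaking. -/
theorem admissible_shuffleDescents_iff (h : IsShuffle a b) (I J : Finset ℕ)
    (k : Fin (m + n) → ℕ) :
    Admissible (m + n) (shuffleDescents (m + n) (positions b) I J) k ↔
      Admissible m I (k ∘ a) ∧ Admissible n J (k ∘ b) ∧ ∀ s t, a s < b t ↔ k (a s) ≤ k (b t) := by
  constructor
  · rintro ⟨hk, hd⟩
    -- Induction on the distance. If the letter after `b t` is from the first word, the forced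
    -- descent is there; otherwise the search continues from that letter.
    have cross : ∀ r s t, (a s : ℕ) - b t = r → b t < a s → k (b t) < k (a s) := by
      intro r
      induction r with
      | zero => intro s t h1 h2; rw [Fin.lt_def] at h2; omega
      | succ r ih =>
        intro s t h1 h2
        rw [Fin.lt_def] at h2
        rcases h.cover ⟨b t + 1, by omega⟩ with ⟨s', hs'⟩ | ⟨t', ht'⟩
        · have hv : (a s' : ℕ) = b t + 1 := by rw [hs']
          have h3 := hd (b t) (a s') hv ((h.mem_shuffleDescents I J hv).1 s' t rfl rfl)
          have h4 : k (a s') ≤ k (a s) := hk (by rw [Fin.le_def]; omega)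
          omega
        · have hv : (b t' : ℕ) = b t + 1 := by rw [ht']
          have hne : (a s : ℕ) ≠ b t' := fun he => h.ne s t' (Fin.ext he)
          have h3 := ih s t' (by omega) (by rw [Fin.lt_def]; omega)
          have h4 : k (b t) ≤ k (b t') := hk (by rw [Fin.le_def]; omega)
          omega
    have cross : ∀ s t, b t < a s → k (b t) < k (a s) := fun s t => cross _ s t rfl
    refine ⟨⟨hk.comp h.left.monotone, ?_⟩, ⟨hk.comp h.right.monotone, ?_⟩, ?_⟩
    · intro s s' hs hI
      have hlt : a s < a s' := h.left (by rw [Fin.lt_def]; omega)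
      rw [Fin.lt_def] at hlt
      by_cases hv : (a s' : ℕ) = a s + 1
      · exact hd _ _ hv (((h.mem_shuffleDescents I J hv).2.2.1 s s' rfl rfl).2 (hs ▸ hI))
      · rcases h.cover ⟨a s + 1, by omega⟩ with ⟨s'', hs''⟩ | ⟨t, ht⟩
        · have hv'' : (a s'' : ℕ) = a s + 1 := by rw [hs'']
          have h1 : s < s'' := h.left.lt_iff_lt.1 (by rw [Fin.lt_def]; omega)
          have h2 : s'' < s' := h.left.lt_iff_lt.1 (by rw [Fin.lt_def]; omega)
          rw [Fin.lt_def] at h1 h2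
          omega
        -- A second-word letter lies between consecutive first-word letters, so strictness comes
        -- from the forced descent and not from `I`.
        · have hv'' : (b t : ℕ) = a s + 1 := by rw [ht]
          have h1 : k (a s) ≤ k (b t) := hk (by rw [Fin.le_def]; omega)
          have h2 := cross s' t (by rw [Fin.lt_def]; omega)
          exact lt_of_le_of_lt h1 h2
    · intro t t' ht hJ
      have hlt : b t < b t' := h.right (by rw [Fin.lt_def]; omega)
      rw [Fin.lt_def] at hlt
      by_cases hv : (b t' : ℕ) = b t + 1
      · exact hd _ _ hv (((h.mem_shuffleDescents I J hv).2.2.2 t t' rfl rfl).2 (ht ▸ hJ))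
      · rcases h.cover ⟨b t + 1, by omega⟩ with ⟨s, hs⟩ | ⟨t'', ht''⟩
        · have hv'' : (a s : ℕ) = b t + 1 := by rw [hs]
          have h1 : k (a s) ≤ k (b t') := hk (by rw [Fin.le_def]; omega)
          have h2 := cross s t (by rw [Fin.lt_def]; omega)
          exact lt_of_lt_of_le h2 h1
        · have hv'' : (b t'' : ℕ) = b t + 1 := by rw [ht'']
          have h1 : t < t'' := h.right.lt_iff_lt.1 (by rw [Fin.lt_def]; omega)
          have h2 : t'' < t' := h.right.lt_iff_lt.1 (by rw [Fin.lt_def]; omega)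
          rw [Fin.lt_def] at h1 h2
          omega
    · intro s t
      refine ⟨fun hst => hk hst.le, fun hst => ?_⟩
      by_contra hlt
      have := cross s t (lt_of_le_of_ne (not_lt.1 hlt) (h.ne s t).symm)
      omega
  · rintro ⟨⟨hi, hI⟩, ⟨hj, hJ⟩, hst⟩
    have hts : ∀ s t, b t < a s → k (b t) < k (a s) := fun s t hlt => by
      have := (hst s t).not.1 (not_lt.2 hlt.le)
      omega
    constructor
    · intro p q hpq
      rcases h.cover p with ⟨s, rfl⟩ | ⟨t, rfl⟩ <;> rcases h.cover q with ⟨s', rfl⟩ | ⟨t', rfl⟩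
      · exact hi (h.left.le_iff_le.1 hpq)
      · exact (hst _ _).1 (lt_of_le_of_ne hpq (h.ne _ _))
      · exact (hts _ _ (lt_of_le_of_ne hpq (h.ne _ _).symm)).le
      · exact hj (h.right.le_iff_le.1 hpq)
    · intro p q hpq hmem
      obtain ⟨-, h2, h3, h4⟩ := h.mem_shuffleDescents I J hpq
      have hlt : p < q := by rw [Fin.lt_def]; omega
      rcases h.cover p with ⟨s, rfl⟩ | ⟨t, rfl⟩ <;> rcases h.cover q with ⟨s', rfl⟩ | ⟨t', rfl⟩
      · have hs : s < s' := h.left.lt_iff_lt.1 hlt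
        have hs1 : (s' : ℕ) = s + 1 := by
          by_contra hne
          rw [Fin.lt_def] at hs
          have e1 : a s < a ⟨s + 1, by omega⟩ := h.left (by rw [Fin.lt_def]; simp)
          have e2 : a ⟨s + 1, by omega⟩ < a s' := h.left (by rw [Fin.lt_def]; simp; omega)
          rw [Fin.lt_def] at e1 e2
          omega
        exact hI s s' hs1 (hs1 ▸ (h3 s s' rfl rfl).1 hmem)
      · exact absurd hmem (h2 s t' rfl rfl)
      · exact hts _ _ hlt
      · have ht : t < t' := h.right.lt_iff_lt.1 hlt
        have ht1 : (t' : ℕ) = t + 1 := by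
          by_contra hne
          rw [Fin.lt_def] at ht
          have e1 : b t < b ⟨t + 1, by omega⟩ := h.right (by rw [Fin.lt_def]; simp)
          have e2 : b ⟨t + 1, by omega⟩ < b t' := h.right (by rw [Fin.lt_def]; simp; omega)
          rw [Fin.lt_def] at e1 e2
          omega
        exact hJ t t' ht1 (ht1 ▸ (h4 t t' rfl rfl).1 hmem)

theorem IsShuffle.sum_comp {B : Type*} [AddCommMonoid B] (h : IsShuffle a b)
    (f : Fin (m + n) → B) : ∑ p, f p = ∑ s, f (a s) + ∑ t, f (b t) := by
  rw [← (Equiv.ofBijective _ h.bijective).sum_comp, Fintype.sum_sum_type]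
  rfl

end Shuffle

/-- The sequences contributing to the coefficient of `L_{comp(I)}` at `d`. -/
abbrev AdmissibleOf (n : ℕ) (I : Finset ℕ) (d : ℕ →₀ ℕ) : Type :=
  {i : Fin n → ℕ // Admissible n I i ∧ ∑ j, Finsupp.single (i j) 1 = d}

instance (n : ℕ) (I : Finset ℕ) (d : ℕ →₀ ℕ) : Finite (AdmissibleOf n I d) := by
  apply Set.Finite.subset (Set.Finite.pi' fun _ : Fin n => d.support.finite_toSet)
  rintro i ⟨-, h⟩ j
  rw [Finset.mem_coe, Finsupp.mem_support_iff, ← h, Finsupp.finsetSum_apply]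
  have := Finset.single_le_sum (f := fun x => Finsupp.single (i x) 1 (i j))
    (fun _ _ => Nat.zero_le _) (Finset.mem_univ j)
  simp only [Finsupp.single_eq_same] at this
  omega

theorem Lset_eq_card (n : ℕ) (I : Finset ℕ) (d : ℕ →₀ ℕ) :
    Lset n I d = Nat.card (AdmissibleOf n I d) := by
  simp only [Lset, AdmissibleOf, Admissible, and_assoc]

/-- The product formula for fundamental quasisymmetric functions. -/
theorem Lset_mul (m n : ℕ) (I J : Finset ℕ) :
    Lset m I * Lset n J =
      ∑ A ∈ (Finset.Icc 1 (m + n)).powersetCard n,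
        Lset (m + n) (shuffleDescents (m + n) A I J) := by
  funext d
  -- Both sides count `T`: the left by splitting the content `d` between the two sequences, the
  -- right by sorting the pairs according to their merge pattern.
  let T := {x : (Fin m → ℕ) × (Fin n → ℕ) // Admissible m I x.1 ∧ Admissible n J x.2 ∧
    ∑ j, Finsupp.single (x.1 j) 1 + ∑ j, Finsupp.single (x.2 j) 1 = d}
  have hl : (Lset m I * Lset n J) d = Nat.card T := by
    refine (MvPowerSeries.coeff_mul d (Lset m I) (Lset n J)).trans ?_
    have h1 : ∀ x : ℕ →₀ ℕ, MvPowerSeries.coeff x (Lset m I) =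
      Nat.card (AdmissibleOf m I x) := Lset_eq_card m I
    have h2 : ∀ x : ℕ →₀ ℕ, MvPowerSeries.coeff x (Lset n J) =
      Nat.card (AdmissibleOf n J x) := Lset_eq_card n J
    simp only [h1, h2]
    rw [← Finset.sum_coe_sort]
    simp only [← Nat.cast_mul, ← Nat.card_prod, ← Nat.cast_sum]
    rw [← Nat.card_sigma]
    congr 1
    refine Nat.card_congr (Equiv.ofBijective (fun y => ⟨(y.2.1.1, y.2.2.1), y.2.1.2.1,
      y.2.2.2.1, ?_⟩) ⟨?_, ?_⟩)
    · rw [y.2.1.2.2, y.2.2.2.2]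
      exact Finset.HasAntidiagonal.mem_antidiagonal.1 y.1.2
    · rintro ⟨⟨⟨u, v⟩, huv⟩, ⟨i, hi, hu⟩, ⟨j, hj, hv⟩⟩
        ⟨⟨⟨u', v'⟩, huv'⟩, ⟨i', hi', hu'⟩, ⟨j', hj', hv'⟩⟩ h
      obtain rfl : i = i' := congrArg (fun z => z.1.1) h
      obtain rfl : j = j' := congrArg (fun z => z.1.2) h
      simp only at hu hv hu' hv'
      subst hu hv hu' hv'
      rfl
    · rintro ⟨⟨i, j⟩, hi, hj, h⟩
      exact ⟨⟨⟨(_, _), Finset.HasAntidiagonal.mem_antidiagonal.2 h⟩, ⟨i, hi, rfl⟩, ⟨j, hj, rfl⟩⟩, rfl⟩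
  rw [hl]
  refine Eq.trans ?_ (Finset.sum_apply d _ fun A =>
    Lset (m + n) (shuffleDescents (m + n) A I J)).symm
  simp only [Lset_eq_card]
  rw [← Finset.sum_coe_sort, ← Nat.cast_sum, ← Nat.card_sigma]
  congr 1
  choose a b hab hA using fun A : (Finset.Icc 1 (m + n)).powersetCard n => exists_isShuffle A.2
  symm
  have hadm : ∀ A : (Finset.Icc 1 (m + n)).powersetCard n, ∀ k,
      Admissible (m + n) (shuffleDescents (m + n) A I J) k ↔
      Admissible m I (k ∘ a A) ∧ Admissible n J (k ∘ b A) ∧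
        ∀ s t, a A s < b A t ↔ k (a A s) ≤ k (b A t) := by
    intro A k
    rw [← admissible_shuffleDescents_iff (hab A), hA]
  refine Nat.card_congr (Equiv.ofBijective (fun y => ⟨(y.2.1 ∘ a y.1, y.2.1 ∘ b y.1),
    ((hadm _ _).1 y.2.2.1).1, ((hadm _ _).1 y.2.2.1).2.1, ?_⟩) ⟨?_, ?_⟩)
  · exact ((hab y.1).sum_comp fun p => Finsupp.single (y.2.1 p) 1).symm.trans y.2.2.2
  · rintro ⟨A, k, hk, hd⟩ ⟨A', k', hk', hd'⟩ h
    have h1 := congrArg (fun z => z.1.1) h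
    have h2 := congrArg (fun z => z.1.2) h
    -- The comparisons of values recover the shuffle, and with it `A`.
    obtain ⟨ha, hb⟩ := (hab A).unique (hab A') fun s t => by
      rw [((hadm _ _).1 hk).2.2, ((hadm _ _).1 hk').2.2]
      exact iff_of_eq (congrArg₂ (· ≤ ·) (congrFun h1 s) (congrFun h2 t))
    obtain rfl : A = A' := by
      apply Subtype.ext
      rw [← hA A, ← hA A', hb]
    obtain rfl : k = k' := by
      funext p
      rcases (hab A).cover p with ⟨s, rfl⟩ | ⟨t, rfl⟩
      · exact congrFun h1 s
      · exact congrFun h2 t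
    rfl
  · rintro ⟨⟨i, j⟩, hi, hj, h⟩
    obtain ⟨a₀, b₀, h₀, hlt⟩ := isShuffle_merge i j hi.1 hj.1
    let A : (Finset.Icc 1 (m + n)).powersetCard n :=
      ⟨positions b₀, positions_mem_powersetCard h₀.right⟩
    -- The chosen shuffle for `A` need not be the merge by definition; increasing maps with the same
    -- range coincide.
    have hbA : b A = b₀ := by
      rw [← (hab A).right.range_inj h₀.right]
      ext p
      have := hA A
      rw [Set.mem_range, Set.mem_range, ← mem_positions, ← mem_positions, this]
    have haA : a A = a₀ := by
      rw [← (hab A).left.range_inj h₀.left]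
      have hc : ∀ {a : Fin m → Fin (m + n)} {b : Fin n → Fin (m + n)}, IsShuffle a b →
          Set.range a = (Set.range b)ᶜ := by
        intro a b h
        ext p
        constructor
        · rintro ⟨s, rfl⟩ ⟨t, ht⟩
          exact h.ne s t ht.symm
        · intro hp
          exact (h.cover p).resolve_right hp
      rw [hc (hab A), hc h₀, hbA]
    let E := Equiv.ofBijective _ h₀.bijective
    let k : Fin (m + n) → ℕ := fun p => Sum.elim i j (E.symm p)
    have hka : ∀ s, k (a₀ s) = i s := fun s => by
      have : E.symm (a₀ s) = Sum.inl s := E.symm_apply_eq.2 rfl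
      simp [k, this]
    have hkb : ∀ t, k (b₀ t) = j t := fun t => by
      have : E.symm (b₀ t) = Sum.inr t := E.symm_apply_eq.2 rfl
      simp [k, this]
    have hka' : k ∘ a₀ = i := funext hka
    have hkb' : k ∘ b₀ = j := funext hkb
    refine ⟨⟨A, k, (hadm A k).2 ?_, ?_⟩, ?_⟩
    · rw [haA, hbA, hka', hkb']
      exact ⟨hi, hj, fun s t => by rw [hka, hkb, hlt]⟩
    · rw [← h, h₀.sum_comp]
      simp only [hka, hkb]
    · apply Subtype.ext
      simp only [haA, hbA, hka', hkb']

end QSymCat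

namespace QSymCat

/-! ## The algebra of quasisymmetric functions -/

theorem M_nil : M [] = 1 := by
  classical
  funext d
  obtain ⟨α, σ, hσ, rfl⟩ := exists_eq_mon d
  rw [M_apply_mon _ _ hσ]
  refine Eq.trans ?_ (MvPowerSeries.coeff_one (σ := ℕ) (R := ℂ) (n := mon α σ)).symm
  refine if_congr ?_ rfl rfl
  constructor
  · rintro rfl
    rfl
  · intro h
    have := degree_mon α σ
    rw [h, map_zero] at this
    cases α with
    | nil => rfl
    | cons a α =>
      have h1 := a.pos
      rw [Comp.size_cons] at this
      omega

theorem QSym_eq_span_Lset :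
    QSym = Submodule.span ℂ (Set.range fun x : SetIndex => Lset x.1 x.2) := by
  have h := congrArg (Submodule.map QSym.subtype) (top_le_iff.1 span_fundamental)
  rw [Submodule.map_span, Submodule.map_top, Submodule.range_subtype, ← Set.range_comp] at h
  exact h.symm

/-- Closure is read off in the fundamental basis, where `Lset_mul` exhibits each product as a sum of
basis elements. -/
theorem mul_mem_QSym {f g : MvPowerSeries ℕ ℂ} (hf : f ∈ QSym) (hg : g ∈ QSym) :
    f * g ∈ QSym := by
  rw [QSym_eq_span_Lset] at hf hg
  have h := Submodule.mul_mem_mul hf hg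
  rw [Submodule.span_mul_span] at h
  refine Submodule.span_le.2 ?_ h
  rintro _ ⟨_, ⟨x, rfl⟩, _, ⟨y, rfl⟩, rfl⟩
  simp only [Lset_mul]
  exact Submodule.sum_mem _ fun A _ => Lset_mem_QSym (shuffleDescents_subset _ _ _ _)

/-- The algebra of quasisymmetric functions. -/
noncomputable def QSymAlg : Subalgebra ℂ (MvPowerSeries ℕ ℂ) :=
  QSym.toSubalgebra (M_nil ▸ M_mem_QSym []) fun _ _ => mul_mem_QSym

/-- The identification of `QSymAlg` with the space `QSym`. -/
noncomputable def algEquivQSym : QSymAlg ≃ₗ[ℂ] QSym where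
  toFun x := ⟨x.1, x.2⟩
  invFun x := ⟨x.1, x.2⟩
  map_add' _ _ := rfl
  map_smul' _ _ := rfl

/-- The monomial basis of `QSymAlg`. -/
noncomputable def basisMAlg : Module.Basis Comp ℂ QSymAlg := basisM.map algEquivQSym.symm

@[simp] theorem coe_basisMAlg (α : Comp) : (basisMAlg α : MvPowerSeries ℕ ℂ) = M α :=
  coe_basisM α

theorem basisMAlg_nil : basisMAlg [] = 1 := Subtype.ext ((coe_basisMAlg []).trans M_nil)

/-- The coefficient functional at the exponent vector `d`. -/
noncomputable def coeffAlg (d : ℕ →₀ ℕ) : QSymAlg →ₗ[ℂ] ℂ :=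
  MvPowerSeries.coeff d ∘ₗ QSymAlg.toSubmodule.subtype

theorem coeffAlg_apply (d : ℕ →₀ ℕ) (f : QSymAlg) :
    coeffAlg d f = (f : MvPowerSeries ℕ ℂ) d := rfl

theorem coeffAlg_mul (d : ℕ →₀ ℕ) (f g : QSymAlg) :
    coeffAlg d (f * g) = ∑ x ∈ Finset.HasAntidiagonal.antidiagonal d, coeffAlg x.1 f * coeffAlg x.2 g :=
  MvPowerSeries.coeff_mul d (f : MvPowerSeries ℕ ℂ) g

theorem coeffAlg_basisMAlg (α β : Comp) {σ : ℕ → ℕ} (hσ : StrictMono σ) :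
    coeffAlg (mon β σ) (basisMAlg α) = if α = β then 1 else 0 := by
  rw [coeffAlg_apply, coe_basisMAlg, M_apply_mon α β hσ]

theorem basisMAlg_coord (α : Comp) : basisMAlg.coord α = coeffAlg (mon α id) := by
  apply basisMAlg.ext
  intro β
  rw [coeffAlg_basisMAlg _ _ strictMono_id, Module.Basis.coord_apply, Module.Basis.repr_self,
    Finsupp.single_apply]

/-! ## The coalgebra of quasisymmetric functions -/

noncomputable instance : CoalgebraStruct ℂ QSymAlg where
  comul := TensorProduct.map algEquivQSym.symm.toLinearMap algEquivQSym.symm.toLinearMap ∘ₗ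
    coproductQSym ∘ₗ algEquivQSym.toLinearMap
  counit := coeffAlg 0

theorem comul_basisMAlg (α : Comp) :
    Coalgebra.comul (R := ℂ) (basisMAlg α) =
      ∑ k ∈ Finset.range (α.length + 1), basisMAlg (α.take k) ⊗ₜ[ℂ] basisMAlg (α.drop k) := by
  have h : algEquivQSym (basisMAlg α) = basisM α := by simp [basisMAlg]
  change TensorProduct.map algEquivQSym.symm.toLinearMap algEquivQSym.symm.toLinearMap
    (coproductQSym (algEquivQSym (basisMAlg α))) = _
  rw [h, coproductQSym, Module.Basis.constr_basis, map_sum]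
  rfl

theorem counit_basisMAlg (α : Comp) :
    Coalgebra.counit (R := ℂ) (basisMAlg α) = if α = [] then 1 else 0 :=
  coeffAlg_basisMAlg α [] strictMono_id

theorem map_algEquivQSym_comul (a : QSymAlg) :
    TensorProduct.map algEquivQSym.toLinearMap algEquivQSym.toLinearMap
      (Coalgebra.comul (R := ℂ) a) = coproductQSym (algEquivQSym a) := by
  change TensorProduct.map _ _ (TensorProduct.map algEquivQSym.symm.toLinearMap
    algEquivQSym.symm.toLinearMap (coproductQSym (algEquivQSym a))) = _
  rw [← LinearMap.comp_apply, ← TensorProduct.map_comp]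
  simp

noncomputable instance : Coalgebra ℂ QSymAlg where
  coassoc := by
    apply basisMAlg.ext
    intro α
    simp only [LinearMap.comp_apply, LinearEquiv.coe_coe, comul_basisMAlg, map_sum,
      LinearMap.rTensor_tmul, LinearMap.lTensor_tmul, TensorProduct.sum_tmul,
      TensorProduct.tmul_sum, TensorProduct.assoc_tmul]
    rw [Finset.sum_sigma', Finset.sum_sigma']
    -- Both sides enumerate pairs of cuts `l ≤ k`: cutting at `k` and then the left piece at `l`
    -- corresponds to cutting at `l` and then the right piece at `k - l`.
    refine Finset.sum_nbij' (fun x => ⟨x.2, x.1 - x.2⟩) (fun x => ⟨x.1 + x.2, x.1⟩) ?_ ?_ ?_ ?_ ?_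
    · rintro ⟨k, l⟩ h
      simp only [Finset.mem_sigma, Finset.mem_range, List.length_take, List.length_drop] at h ⊢
      omega
    · rintro ⟨k, l⟩ h
      simp only [Finset.mem_sigma, Finset.mem_range, List.length_take, List.length_drop] at h ⊢
      omega
    · rintro ⟨k, l⟩ h
      simp only [Finset.mem_sigma, Finset.mem_range, List.length_take] at h
      simp only [Sigma.mk.injEq, heq_eq_eq, and_true]
      omega
    · rintro ⟨k, l⟩ h
      simp
    · rintro ⟨k, l⟩ h
      simp only [Finset.mem_sigma, Finset.mem_range, List.length_take] at h
      have h1 : min l k = l := by omega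
      have h2 : l + (k - l) = k := by omega
      simp only [List.take_take, List.drop_drop, List.drop_take, h1, h2]
  rTensor_counit_comp_comul := by
    apply basisMAlg.ext
    intro α
    simp only [LinearMap.comp_apply, comul_basisMAlg, map_sum, LinearMap.rTensor_tmul,
      counit_basisMAlg]
    rw [Finset.sum_eq_single 0]
    · simp
    · intro k hk h0
      have : α.take k ≠ [] := by
        rw [Finset.mem_range] at hk
        intro h
        have := congrArg List.length h
        rw [List.length_take, List.length_nil] at this
        cases α with
        | nil => simp at hk; omega
        | cons a α => simp at this; omega
      rw [if_neg this, TensorProduct.zero_tmul]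
    · simp
  lTensor_counit_comp_comul := by
    apply basisMAlg.ext
    intro α
    simp only [LinearMap.comp_apply, comul_basisMAlg, map_sum, LinearMap.lTensor_tmul,
      counit_basisMAlg]
    rw [Finset.sum_eq_single α.length]
    · simp
    · intro k hk h0
      have : α.drop k ≠ [] := by
        rw [Finset.mem_range] at hk
        rw [Ne, List.drop_eq_nil_iff]
        omega
      rw [if_neg this, TensorProduct.tmul_zero]
    · simp

/-! ## Compatibility of the product and the coproduct -/

/-- The coefficient functional of a tensor at a pair of exponent vectors. -/
noncomputable def coeffTensor (d e : ℕ →₀ ℕ) : QSymAlg ⊗[ℂ] QSymAlg →ₗ[ℂ] ℂ :=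
  LinearMap.mul' ℂ ℂ ∘ₗ TensorProduct.map (coeffAlg d) (coeffAlg e)

@[simp] theorem coeffTensor_tmul (d e : ℕ →₀ ℕ) (f g : QSymAlg) :
    coeffTensor d e (f ⊗ₜ g) = coeffAlg d f * coeffAlg e g := rfl

/-- Coefficients at pairs of packed monomials are the coordinates in the tensor square of the
monomial basis. -/
theorem tensor_ext {x y : QSymAlg ⊗[ℂ] QSymAlg}
    (h : ∀ β γ, coeffTensor (mon β id) (mon γ id) x = coeffTensor (mon β id) (mon γ id) y) :
    x = y := by
  apply (basisMAlg.tensorProduct basisMAlg).ext_elem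
  rintro ⟨β, γ⟩
  have key : (basisMAlg.tensorProduct basisMAlg).coord (β, γ) =
      coeffTensor (mon β id) (mon γ id) := by
    apply TensorProduct.ext'
    intro f g
    rw [coeffTensor_tmul, ← basisMAlg_coord, ← basisMAlg_coord]
    simp [mul_comm]
  have := h β γ
  rwa [← key] at this

theorem coeffTensor_mul (d e : ℕ →₀ ℕ) (x y : QSymAlg ⊗[ℂ] QSymAlg) :
    coeffTensor d e (x * y) = ∑ u ∈ Finset.HasAntidiagonal.antidiagonal d, ∑ v ∈ Finset.HasAntidiagonal.antidiagonal e,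
      coeffTensor u.1 v.1 x * coeffTensor u.2 v.2 y := by
  induction x using TensorProduct.induction_on with
  | zero => simp
  | add x x' hx hx' => simp only [add_mul, map_add, hx, hx', Finset.sum_add_distrib]
  | tmul f g =>
    induction y using TensorProduct.induction_on with
    | zero => simp
    | add y y' hy hy' => simp only [mul_add, map_add, hy, hy', Finset.sum_add_distrib]
    | tmul f' g' =>
      rw [Algebra.TensorProduct.tmul_mul_tmul]
      simp only [coeffTensor_tmul, coeffAlg_mul, Finset.sum_mul_sum]
      exact Finset.sum_congr rfl fun u _ => Finset.sum_congr rfl fun v _ => by ring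

/-! ### The coproduct as a splitting of the alphabet -/

/-- The exponent vector `e` shifted by `N`. -/
noncomputable def shift (N : ℕ) (e : ℕ →₀ ℕ) : ℕ →₀ ℕ := e.mapDomain (· + N)

theorem shift_apply (N : ℕ) (e : ℕ →₀ ℕ) (x : ℕ) :
    shift N e x = if N ≤ x then e (x - N) else 0 := by
  unfold shift
  split_ifs with h
  · conv_lhs => rw [← Nat.sub_add_cancel h]
    exact Finsupp.mapDomain_apply (add_left_injective N) e (x - N)
  · apply Finsupp.mapDomain_of_notMem_range
    rintro ⟨y, rfl⟩
    simp at h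

/-- The two summands live on disjoint sets of variables, those below `N` and those from `N` on. A
decomposition of the sum is therefore an independent choice of decompositions of each. -/
theorem sum_antidiagonal_add_shift {B : Type*} [AddCommMonoid B] {N : ℕ} {d e : ℕ →₀ ℕ}
    (hd : ∀ x, N ≤ x → d x = 0) (F : (ℕ →₀ ℕ) → (ℕ →₀ ℕ) → B) :
    ∑ x ∈ Finset.HasAntidiagonal.antidiagonal (d + shift N e), F x.1 x.2 =
      ∑ u ∈ Finset.HasAntidiagonal.antidiagonal d, ∑ v ∈ Finset.HasAntidiagonal.antidiagonal e,
        F (u.1 + shift N v.1) (u.2 + shift N v.2) := by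
  rw [← Finset.sum_product']
  symm
  have hdec : ∀ w : ℕ →₀ ℕ, w.filter (· < N) +
      shift N (w.comapDomain (· + N) (add_left_injective N).injOn) = w := by
    intro w
    ext x
    rw [Finsupp.add_apply, Finsupp.filter_apply, shift_apply, Finsupp.comapDomain_apply]
    split_ifs with h1 h2 h2
    · omega
    · rw [add_zero]
    · rw [Nat.sub_add_cancel h2, zero_add]
    · omega
  refine Finset.sum_nbij' (fun z => (z.1.1 + shift N z.2.1, z.1.2 + shift N z.2.2))
    (fun w => ((w.1.filter (· < N), w.2.filter (· < N)),
      (w.1.comapDomain (· + N) (add_left_injective N).injOn,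
        w.2.comapDomain (· + N) (add_left_injective N).injOn))) ?_ ?_ ?_ ?_ ?_
  · rintro ⟨⟨u, u'⟩, v, v'⟩ h
    simp only [Finset.mem_product, Finset.HasAntidiagonal.mem_antidiagonal] at h ⊢
    rw [← h.1, ← h.2, shift, shift, shift, Finsupp.mapDomain_add]
    abel
  · rintro ⟨w, w'⟩ h
    simp only [Finset.mem_product, Finset.HasAntidiagonal.mem_antidiagonal] at h ⊢
    constructor
    · ext x
      have := DFunLike.congr_fun h x
      simp only [Finsupp.add_apply, Finsupp.filter_apply, shift_apply] at this ⊢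
      split_ifs with hx
      · rw [this, if_neg (by omega), add_zero]
      · rw [hd x (by omega), add_zero]
    · ext x
      have := DFunLike.congr_fun h (x + N)
      simp only [Finsupp.add_apply, shift_apply, hd (x + N) (by omega)] at this
      simpa [Finsupp.comapDomain_apply] using this
  · rintro ⟨⟨u, u'⟩, v, v'⟩ h
    simp only [Finset.mem_product, Finset.HasAntidiagonal.mem_antidiagonal] at h
    have hz : ∀ x, N ≤ x → u x = 0 ∧ u' x = 0 := by
      intro x hx
      have := hd x hx
      rw [← h.1, Finsupp.add_apply] at this
      omega
    have h1 : ∀ u v : ℕ →₀ ℕ, (∀ x, N ≤ x → u x = 0) →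
        (u + shift N v).filter (· < N) = u := by
      intro u v hu
      ext x
      simp only [Finsupp.add_apply, Finsupp.filter_apply, shift_apply]
      by_cases hx : x < N
      · rw [if_pos hx, if_neg (by omega), add_zero]
      · rw [if_neg hx, hu x (by omega)]
    have h2 : ∀ u v : ℕ →₀ ℕ, (∀ x, N ≤ x → u x = 0) →
        (u + shift N v).comapDomain (· + N) (add_left_injective N).injOn = v := by
      intro u v hu
      ext x
      simp [Finsupp.comapDomain_apply, shift_apply, hu (x + N) (by omega)]
    simp only [h1 u v fun x hx => (hz x hx).1, h1 u' v' fun x hx => (hz x hx).2,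
      h2 u v fun x hx => (hz x hx).1, h2 u' v' fun x hx => (hz x hx).2]
  · rintro ⟨w, w'⟩ -
    simp only [hdec]
  · rintro ⟨⟨u, u'⟩, v, v'⟩ -
    rfl

theorem mon_add_shift {β γ : Comp} {σ τ : ℕ → ℕ} (hσ : StrictMono σ) (hτ : StrictMono τ) {N : ℕ}
    (hN : ∀ x, N ≤ x → mon β σ x = 0) :
    ∃ ρ, StrictMono ρ ∧ mon β σ + shift N (mon γ τ) = mon (β ++ γ) ρ := by
  have hlt : ∀ j < β.length, σ j < N := by
    intro j hj
    by_contra h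
    have h1 := hN (σ j) (by omega)
    rw [mon, Finsupp.finsetSum_apply, Finset.sum_eq_zero_iff] at h1
    have := h1 ⟨j, hj⟩ (Finset.mem_univ _)
    simp at this
  refine ⟨fun j => if j < β.length then σ j else τ (j - β.length) + N, ?_, ?_⟩
  · intro x y hxy
    dsimp only
    split_ifs with hx hy hy
    · exact hσ hxy
    · have := hlt x hx
      omega
    · omega
    · have := hτ (show x - β.length < y - β.length by omega)
      omega
  · rw [mon_append, shift, mapDomain_mon]
    congr 1
    · exact mon_congr fun j hj => by simp [hj]
    · exact mon_congr fun j hj => by simp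

/-- Deconcatenation is evaluation on an ordered alphabet cut in two: when `d` uses only variables
below `N`, its exponents and those of the shifted `e` concatenate. For a monomial function the cut
is forced to be at the number of nonzero exponents of `d`. -/
theorem coeffTensor_comul (f : QSymAlg) {d e : ℕ →₀ ℕ} {N : ℕ} (hd : ∀ x, N ≤ x → d x = 0) :
    coeffTensor d e (Coalgebra.comul f) = coeffAlg (d + shift N e) f := by
  obtain ⟨β, σ, hσ, rfl⟩ := exists_eq_mon d
  obtain ⟨γ, τ, hτ, rfl⟩ := exists_eq_mon e
  obtain ⟨ρ, hρ, h⟩ := mon_add_shift hσ hτ hd (γ := γ)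
  rw [h, ← LinearMap.comp_apply]
  congr 1
  apply basisMAlg.ext
  intro α
  rw [coeffAlg_basisMAlg _ _ hρ, LinearMap.comp_apply, comul_basisMAlg, map_sum]
  simp only [coeffTensor_tmul, coeffAlg_basisMAlg _ _ hσ, coeffAlg_basisMAlg _ _ hτ]
  split_ifs with hα
  · subst hα
    rw [Finset.sum_eq_single β.length]
    · simp
    · intro k hk hne
      rw [if_neg, zero_mul]
      intro h
      have := congrArg List.length h
      rw [List.length_take] at this
      rw [Finset.mem_range] at hk
      omega
    · simp
  · apply Finset.sum_eq_zero
    intro k hk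
    by_contra h
    obtain ⟨h1, h2⟩ := ne_zero_and_ne_zero_of_mul h
    rw [Ne, ite_eq_right_iff, Classical.not_imp] at h1 h2
    exact hα (by rw [← h1.1, ← h2.1, List.take_append_drop])

theorem exists_forall_eq_zero (d : ℕ →₀ ℕ) : ∃ N, ∀ x, N ≤ x → d x = 0 := by
  refine ⟨d.support.sup id + 1, fun x hx => ?_⟩
  by_contra h
  have := Finset.le_sup (f := id) (Finsupp.mem_support_iff.2 h)
  simp only [id] at this
  omega

/-- Once the coproduct is a splitting of variables, this is the convolution formula for
coefficients, applied on the joint alphabet and on its two pieces. -/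
theorem comul_mul_QSymAlg (f g : QSymAlg) :
    Coalgebra.comul (R := ℂ) (f * g) = Coalgebra.comul (R := ℂ) f * Coalgebra.comul (R := ℂ) g := by
  apply tensor_ext
  intro β γ
  obtain ⟨N, hN⟩ := exists_forall_eq_zero (mon β id)
  rw [coeffTensor_comul _ hN, coeffAlg_mul, coeffTensor_mul,
    sum_antidiagonal_add_shift hN fun x y => coeffAlg x f * coeffAlg y g]
  refine Finset.sum_congr rfl fun u hu => Finset.sum_congr rfl fun v _ => ?_
  have hu : ∀ x, N ≤ x → u.1 x = 0 ∧ u.2 x = 0 := by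
    intro x hx
    have := hN x hx
    rw [← Finset.HasAntidiagonal.mem_antidiagonal.1 hu, Finsupp.add_apply] at this
    omega
  rw [coeffTensor_comul f fun x hx => (hu x hx).1, coeffTensor_comul g fun x hx => (hu x hx).2]

noncomputable instance : Bialgebra ℂ QSymAlg :=
  Bialgebra.mk' ℂ QSymAlg
    (counit_one := by rw [← basisMAlg_nil]; exact counit_basisMAlg [])
    (counit_mul := fun {f g} => (coeffAlg_mul 0 f g).trans (by
      simp; rfl))
    (comul_one := by
      rw [← basisMAlg_nil]
      refine (comul_basisMAlg []).trans ?_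
      simp [basisMAlg_nil, Algebra.TensorProduct.one_def])
    (comul_mul := fun {f g} => comul_mul_QSymAlg f g)

/-! ## The antipode -/

/-- The left convolution inverse of the identity on the monomial basis. -/
noncomputable def leftAntipode (α : Comp) : QSymAlg :=
  if α = [] then 1
  else -∑ k : Fin α.length, leftAntipode (α.take k) * basisMAlg (α.drop k)
termination_by α.length
decreasing_by have := k.2; simp only [List.length_take]; omega

/-- The right convolution inverse of the identity on the monomial basis. -/
noncomputable def rightAntipode (α : Comp) : QSymAlg :=
  if α = [] then 1
  else -∑ k : Fin α.length, basisMAlg (α.take (k + 1)) * rightAntipode (α.drop (k + 1))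
termination_by α.length
decreasing_by have := k.2; simp only [List.length_drop]; omega

theorem sum_leftAntipode (α : Comp) :
    ∑ k ∈ Finset.range (α.length + 1), leftAntipode (α.take k) * basisMAlg (α.drop k) =
      if α = [] then 1 else 0 := by
  rw [Finset.sum_range_succ, List.take_length, List.drop_length, basisMAlg_nil, mul_one,
    Finset.sum_range]
  split_ifs with h
  · subst h
    simp [leftAntipode]
  · rw [leftAntipode, if_neg h, add_neg_cancel]

theorem sum_rightAntipode (α : Comp) :
    ∑ k ∈ Finset.range (α.length + 1), basisMAlg (α.take k) * rightAntipode (α.drop k) =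
      if α = [] then 1 else 0 := by
  rw [Finset.sum_range_succ', List.take_zero, List.drop_zero, basisMAlg_nil, one_mul,
    Finset.sum_range]
  split_ifs with h
  · subst h
    simp [rightAntipode]
  · rw [rightAntipode, if_neg h, add_neg_cancel]

theorem mul_rTensor_leftAntipode :
    LinearMap.mul' ℂ QSymAlg ∘ₗ (basisMAlg.constr ℂ leftAntipode).rTensor QSymAlg ∘ₗ
      Coalgebra.comul = Algebra.linearMap ℂ QSymAlg ∘ₗ Coalgebra.counit := by
  apply basisMAlg.ext
  intro α
  simp only [LinearMap.comp_apply, comul_basisMAlg, counit_basisMAlg, map_sum,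
    LinearMap.rTensor_tmul, LinearMap.mul'_apply, Module.Basis.constr_basis, sum_leftAntipode]
  split_ifs <;> simp

theorem mul_lTensor_rightAntipode :
    LinearMap.mul' ℂ QSymAlg ∘ₗ (basisMAlg.constr ℂ rightAntipode).lTensor QSymAlg ∘ₗ
      Coalgebra.comul = Algebra.linearMap ℂ QSymAlg ∘ₗ Coalgebra.counit := by
  apply basisMAlg.ext
  intro α
  simp only [LinearMap.comp_apply, comul_basisMAlg, counit_basisMAlg, map_sum,
    LinearMap.lTensor_tmul, LinearMap.mul'_apply, Module.Basis.constr_basis, sum_rightAntipode]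
  split_ifs <;> simp

/-- In the convolution algebra of endomorphisms, a left and a right inverse of the identity map
coincide. -/
theorem leftAntipode_eq_rightAntipode :
    basisMAlg.constr ℂ leftAntipode = basisMAlg.constr ℂ rightAntipode := by
  have h1 : WithConv.toConv (basisMAlg.constr ℂ leftAntipode) *
      WithConv.toConv (LinearMap.id : QSymAlg →ₗ[ℂ] QSymAlg) = 1 :=
    congrArg WithConv.toConv mul_rTensor_leftAntipode
  have h2 : WithConv.toConv (LinearMap.id : QSymAlg →ₗ[ℂ] QSymAlg) *
      WithConv.toConv (basisMAlg.constr ℂ rightAntipode) = 1 :=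
    congrArg WithConv.toConv mul_lTensor_rightAntipode
  exact congrArg WithConv.ofConv (left_inv_eq_right_inv h1 h2)

noncomputable instance : HopfAlgebra ℂ QSymAlg where
  antipode := basisMAlg.constr ℂ leftAntipode
  mul_antipode_rTensor_comul := mul_rTensor_leftAntipode
  mul_antipode_lTensor_comul := by
    rw [leftAntipode_eq_rightAntipode]
    exact mul_lTensor_rightAntipode

/-! ## The coproduct of fundamental quasisymmetric functions -/

theorem exists_size_take_append (β γ : Comp) (p : ℕ) :
    (∃ k, Comp.size ((β ++ γ).take k) = p) ↔
      (∃ k, Comp.size (β.take k) = p) ∨ ∃ k, Comp.size β + Comp.size (γ.take k) = p := by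
  constructor
  · rintro ⟨k, rfl⟩
    rw [List.take_append, Comp.size_append]
    rcases le_total k β.length with h | h
    · exact Or.inl ⟨k, by simp [Nat.sub_eq_zero_of_le h]⟩
    · exact Or.inr ⟨k - β.length, by rw [List.take_of_length_le h]⟩
  · rintro (⟨k, rfl⟩ | ⟨k, rfl⟩)
    · rcases le_total k β.length with h | h
      · exact ⟨k, by rw [List.take_append, Nat.sub_eq_zero_of_le h]; simp⟩
      · exact ⟨β.length, by rw [List.take_of_length_le h]; simp⟩
    · exact ⟨β.length + k, by rw [List.take_append, List.take_of_length_le (by omega),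
        Nat.add_sub_cancel_left, Comp.size_append]⟩

theorem Comp.size_take_le (α : Comp) (k : ℕ) : Comp.size (α.take k) ≤ Comp.size α := by
  conv_rhs => rw [← List.take_append_drop k α, Comp.size_append]
  omega

/-- The part of `I` to the left of `k`. -/
def cutLeft (k : ℕ) (I : Finset ℕ) : Finset ℕ := (idx k).filter (· ∈ I)

/-- The part of `I` in `[k + 1, n - 1]`, shifted by `-k`. -/
def cutRight (n k : ℕ) (I : Finset ℕ) : Finset ℕ := (idx (n - k)).filter (· + k ∈ I)

theorem cutLeft_subset (k : ℕ) (I : Finset ℕ) : cutLeft k I ⊆ idx k := Finset.filter_subset _ _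

theorem cutRight_subset (n k : ℕ) (I : Finset ℕ) : cutRight n k I ⊆ idx (n - k) :=
  Finset.filter_subset _ _

/-- The partial sums of a concatenation are those of `β`, the joint `|β|`, and those of `γ` shifted
by `|β|`. The joint is always present, so it imposes nothing on `I`, which is why the two cuts may
drop it. -/
theorem subset_set_append_iff {β γ : Comp} {I : Finset ℕ}
    (hI : I ⊆ idx (Comp.size β + Comp.size γ)) :
    I ⊆ Comp.set (β ++ γ) ↔ cutLeft (Comp.size β) I ⊆ Comp.set β ∧
      cutRight (Comp.size β + Comp.size γ) (Comp.size β) I ⊆ Comp.set γ := by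
  have hm : ∀ p, p ∈ Comp.set (β ++ γ) ↔ 0 < p ∧ p < Comp.size β + Comp.size γ ∧
      ((∃ k, Comp.size (β.take k) = p) ∨ ∃ k, Comp.size β + Comp.size (γ.take k) = p) := by
    intro p
    rw [Comp.mem_set, exists_size_take_append, Comp.size_append]
  have h0 := Comp.size_take_le β
  constructor
  · intro h
    constructor
    · intro p hp
      obtain ⟨hp, hpI⟩ := Finset.mem_filter.1 hp
      rw [Finset.mem_Icc] at hp
      obtain ⟨-, -, h1 | ⟨k, hk⟩⟩ := (hm p).1 (h hpI)
      · exact Comp.mem_set.2 ⟨by omega, by omega, h1⟩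
      · omega
    · intro p hp
      obtain ⟨hp, hpI⟩ := Finset.mem_filter.1 hp
      rw [Finset.mem_Icc] at hp
      obtain ⟨-, -, ⟨k, hk⟩ | ⟨k, hk⟩⟩ := (hm _).1 (h hpI)
      · have := h0 k
        omega
      · exact Comp.mem_set.2 ⟨by omega, by omega, k, by omega⟩
  · rintro ⟨h1, h2⟩ p hp
    have hp' := Finset.mem_Icc.1 (hI hp)
    refine (hm p).2 ⟨by omega, by omega, ?_⟩
    rcases lt_trichotomy p (Comp.size β) with h | h | h
    · left
      exact (Comp.mem_set.1 (h1 (Finset.mem_filter.2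
        ⟨Finset.mem_Icc.2 (by omega), hp⟩))).2.2
    · left
      exact ⟨β.length, by rw [List.take_length, h]⟩
    · right
      obtain ⟨-, -, k, hk⟩ := Comp.mem_set.1 (h2 (Finset.mem_filter.2
        (⟨Finset.mem_Icc.2 (by omega), by rwa [Nat.sub_add_cancel h.le]⟩ :
          p - Comp.size β ∈ idx _ ∧ _)))
      exact ⟨k, by omega⟩

/-- The fundamental quasisymmetric functions as elements of `QSymAlg`. -/
noncomputable def fundamentalAlg (n : ℕ) (I : Finset ℕ) (hI : I ⊆ idx n) : QSymAlg :=
  ⟨Lset n I, Lset_mem_QSym hI⟩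

theorem coeffAlg_fundamentalAlg {n : ℕ} {I : Finset ℕ} (hI : I ⊆ idx n) (α : Comp) {σ : ℕ → ℕ}
    (hσ : StrictMono σ) : coeffAlg (mon α σ) (fundamentalAlg n I hI) =
      if Comp.size α = n ∧ I ⊆ Comp.set α then 1 else 0 :=
  Lset_apply_mon hI α hσ

/-- At a pair `(β, γ)` only the cut `k = |β|` can contribute, and there the condition on `β · γ`
splits into one on each factor. -/
theorem comul_fundamentalAlg {n : ℕ} {I : Finset ℕ} (hI : I ⊆ idx n) :
    Coalgebra.comul (R := ℂ) (fundamentalAlg n I hI) =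
      ∑ k ∈ Finset.range (n + 1), fundamentalAlg k (cutLeft k I) (cutLeft_subset k I) ⊗ₜ[ℂ]
        fundamentalAlg (n - k) (cutRight n k I) (cutRight_subset n k I) := by
  apply tensor_ext
  intro β γ
  obtain ⟨N, hN⟩ := exists_forall_eq_zero (mon β id)
  obtain ⟨ρ, hρ, h⟩ := mon_add_shift strictMono_id strictMono_id hN (γ := γ)
  rw [coeffTensor_comul _ hN, h, coeffAlg_fundamentalAlg hI _ hρ, map_sum]
  simp only [coeffTensor_tmul, coeffAlg_fundamentalAlg _ _ strictMono_id,
    ite_zero_mul_ite_zero, mul_one]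
  by_cases hn : Comp.size β + Comp.size γ = n
  · subst hn
    rw [Finset.sum_eq_single (Comp.size β)]
    · refine if_congr ?_ rfl rfl
      rw [Comp.size_append, subset_set_append_iff hI, Nat.add_sub_cancel_left]
      simp
    · intro k _ hk
      rw [if_neg]
      rintro ⟨⟨h, -⟩, -⟩
      exact hk h.symm
    · intro h
      exact absurd (Finset.mem_range.2 (by omega)) h
  · rw [if_neg (by rw [Comp.size_append]; exact fun h => hn h.1)]
    symm
    apply Finset.sum_eq_zero
    intro k hk
    rw [Finset.mem_range] at hk
    rw [if_neg]
    rintro ⟨⟨h1, -⟩, h2, -⟩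
    omega

end QSymCat

namespace QSymCat

/-! ## Irreducible characters of `Q_S(ν)` -/

/-- Irreducible representations of an abelian group are one-dimensional, where trace and determinant
agree. The determinant supplies the multiplicativity. -/
theorem mem_Irr_iff {G : Type} [CommGroup G] (ψ : G → ℂ) :
    ψ ∈ Irr G ↔ ∃ χ : G →* ℂ, ∀ g, ψ g = χ g := by
  constructor
  · rintro ⟨d, ρ, hρ, rfl⟩
    have hd : d = 1 := by
      have h := Representation.IsIrreducible.finrank_eq_one_of_isMulCommutative ρ
      simpa using h
    subst hd
    refine ⟨LinearMap.det.comp ρ, fun g => ?_⟩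
    rw [Representation.character, MonoidHom.comp_apply, ← LinearMap.det_toMatrix',
      ← Matrix.toLin'_toMatrix' (ρ g), Matrix.trace_toLin'_eq, LinearMap.toMatrix'_toLin',
      Matrix.det_fin_one, Matrix.trace_fin_one]
  · rintro ⟨χ, hχ⟩
    let ρ : Representation ℂ G (Fin 1 → ℂ) :=
      (algebraMap ℂ (Module.End ℂ (Fin 1 → ℂ))).toMonoidHom.comp χ
    refine ⟨1, ρ, ?_, ?_⟩
    · have hs : IsSimpleOrder (Submodule ℂ (Fin 1 → ℂ)) :=
        is_simple_module_of_finrank_eq_one (Module.finrank_fin_fun ℂ)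
      refine { exists_pair_ne := ⟨⊥, ⊤, fun h => ?_⟩, eq_bot_or_eq_top := fun N => ?_ }
      · exact bot_ne_top (congrArg Subrepresentation.toSubmodule h)
      · rcases hs.eq_bot_or_eq_top N.toSubmodule with h | h
        · exact Or.inl (Subrepresentation.toSubmodule_injective h)
        · exact Or.inr (Subrepresentation.toSubmodule_injective h)
    · funext g
      rw [hχ]
      change LinearMap.trace ℂ _ (algebraMap ℂ (Module.End ℂ (Fin 1 → ℂ)) (χ g)) = χ g
      rw [Algebra.algebraMap_eq_smul_one, map_smul, LinearMap.trace_one]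
      simp

variable {ν : ℕ}

/-- The product of characters of the components. -/
noncomputable def prodChar {S : Finset ℕ} (ψ : S → AddChar (ZMod ν) ℂ) : Cf ν S :=
  fun g => ∏ s, ψ s (g s).toAdd

theorem prodChar_one {S : Finset ℕ} (ψ : S → AddChar (ZMod ν) ℂ) : prodChar ψ 1 = 1 := by
  simp [prodChar]

theorem prodChar_mulSingle {S : Finset ℕ} (ψ : S → AddChar (ZMod ν) ℂ) (s : S) (a : Cyc ν) :
    prodChar ψ (Pi.mulSingle s a) = ψ s a.toAdd := by
  unfold prodChar
  rw [Finset.prod_eq_single s]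
  · rw [Pi.mulSingle_eq_same]
  · intro t _ h
    rw [Pi.mulSingle_eq_of_ne h, toAdd_one, AddChar.map_zero_eq_one]
  · simp

theorem prodChar_injective {S : Finset ℕ} :
    Function.Injective (prodChar : (S → AddChar (ZMod ν) ℂ) → Cf ν S) := by
  intro ψ ψ' h
  funext s
  ext a
  have := congrFun h (Pi.mulSingle s (Multiplicative.ofAdd a))
  rwa [prodChar_mulSingle, prodChar_mulSingle] at this

theorem mem_Irr_Q_iff {S : Finset ℕ} (f : Cf ν S) :
    f ∈ Irr (Q ν S) ↔ ∃ ψ : S → AddChar (ZMod ν) ℂ, prodChar ψ = f := by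
  rw [mem_Irr_iff]
  constructor
  · rintro ⟨χ, hχ⟩
    refine ⟨fun s => AddChar.toMonoidHomEquiv.symm
      (χ.comp (MonoidHom.mulSingle (fun _ : S => Cyc ν) s)), ?_⟩
    funext g
    rw [hχ]
    conv_rhs => rw [← Finset.univ_prod_mulSingle g, map_prod]
    rfl
  · rintro ⟨ψ, rfl⟩
    refine ⟨∏ s, (AddChar.toMonoidHomEquiv (ψ s)).comp
      (Pi.evalMonoidHom (fun _ : S => Cyc ν) s), fun g => ?_⟩
    rw [MonoidHom.finsetProd_apply]
    rfl

/-! ## The lattice of subgroups -/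

theorem subQ_mono {S I J : Finset ℕ} (h : ∀ s ∈ S, s ∈ I → s ∈ J) : subQ ν S I ≤ subQ ν S J :=
  fun _ hg s hs => hg s fun hI => hs (h s s.2 hI)

/-- Since `ν > 1`, a nontrivial element supported at a single index detects whether this index is
allowed. -/
theorem subQ_le_iff (hν : 1 < ν) {S I J : Finset ℕ} :
    subQ ν S I ≤ subQ ν S J ↔ ∀ s ∈ S, s ∈ I → s ∈ J := by
  refine ⟨fun h s hs hI => ?_, subQ_mono⟩
  by_contra hJ
  have : Fact (1 < ν) := ⟨hν⟩
  have hmem : (Pi.mulSingle ⟨s, hs⟩ (Multiplicative.ofAdd 1) : Q ν S) ∈ subQ ν S I := by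
    intro t ht
    exact Pi.mulSingle_eq_of_ne (fun he => ht (by rw [he]; exact hI)) _
  have h1 := h hmem ⟨s, hs⟩ hJ
  rw [Pi.mulSingle_eq_same] at h1
  exact one_ne_zero (Multiplicative.ofAdd.injective h1 : (1 : ZMod ν) = 0)

theorem covers_insert (hν : 1 < ν) {S I : Finset ℕ} (hI : I ⊆ S) {s : ℕ} (hs : s ∈ S)
    (hsI : s ∉ I) : Covers (lattice ν S) (subQ ν S I) (subQ ν S (insert s I)) := by
  refine ⟨⟨I, hI, rfl⟩, ⟨_, Finset.insert_subset hs hI, rfl⟩, ?_, ?_⟩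
  · rw [lt_iff_le_not_ge, subQ_le_iff hν, subQ_le_iff hν]
    exact ⟨fun t _ ht => Finset.mem_insert_of_mem ht,
      fun h => hsI (h s hs (Finset.mem_insert_self _ _))⟩
  · rintro _ ⟨J, hJ, rfl⟩ h1 h2
    rw [lt_iff_le_not_ge, subQ_le_iff hν, subQ_le_iff hν] at h1 h2
    by_cases hsJ : s ∈ J
    · apply h2.2
      intro t ht h
      rcases Finset.mem_insert.1 h with rfl | h
      · exact hsJ
      · exact h1.1 t ht h
    · apply h1.2
      intro t ht h
      rcases Finset.mem_insert.1 (h2.1 t ht h) with rfl | h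
      · exact absurd h hsJ
      · exact h

/-- The kernel contains `Q_J` exactly when every component indexed by `J` is trivial. Testing the
covers that adjoin one index to `I` forces each remaining component to be nontrivial. -/
theorem mem_charBlock_iff (hν : 1 < ν) {S I : Finset ℕ} (hI : I ⊆ S) (f : Cf ν S) :
    f ∈ charBlock (lattice ν S) (subQ ν S I) ↔
      ∃ ψ : S → AddChar (ZMod ν) ℂ, (∀ s, ψ s = 0 ↔ (s : ℕ) ∈ I) ∧ prodChar ψ = f := by
  have htriv : ∀ (ψ : S → AddChar (ZMod ν) ℂ) (J : Finset ℕ),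
      (∀ g ∈ subQ ν S J, prodChar ψ g = prodChar ψ 1) ↔ ∀ s : S, (s : ℕ) ∈ J → ψ s = 0 := by
    intro ψ J
    constructor
    · intro h s hs
      ext a
      have hmem : (Pi.mulSingle s (Multiplicative.ofAdd a) : Q ν S) ∈ subQ ν S J := by
        intro t ht
        exact Pi.mulSingle_eq_of_ne (fun he => ht (by rw [he]; exact hs)) _
      have := h _ hmem
      rwa [prodChar_mulSingle, prodChar_one] at this
    · intro h g hg
      rw [prodChar_one]
      apply Finset.prod_eq_one
      intro s _
      by_cases hs : (s : ℕ) ∈ J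
      · rw [h s hs, AddChar.zero_apply]
      · rw [hg s hs, toAdd_one, AddChar.map_zero_eq_one]
  simp only [charBlock, Set.mem_ofPred_eq, mem_Irr_Q_iff]
  constructor
  · rintro ⟨⟨ψ, rfl⟩, h1, h2⟩
    rw [htriv] at h1
    refine ⟨ψ, fun s => ⟨fun h => ?_, h1 s⟩, rfl⟩
    by_contra hs
    apply h2 _ (covers_insert hν hI s.2 hs)
    rw [htriv]
    intro t ht
    rcases Finset.mem_insert.1 ht with ht | ht
    · rw [Subtype.ext ht, h]
    · exact h1 t ht
  · rintro ⟨ψ, hψ, rfl⟩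
    refine ⟨⟨ψ, rfl⟩, (htriv ψ I).2 fun s hs => (hψ s).2 hs, ?_⟩
    rintro _ ⟨-, ⟨J, hJ, rfl⟩, hlt, -⟩ h
    rw [htriv] at h
    refine hlt.not_ge ((subQ_le_iff hν).2 fun s hs hsJ => ?_)
    exact (hψ ⟨s, hs⟩).1 (h ⟨s, hs⟩ hsJ)

/-! ### Factorization of normalized supercharacters -/

theorem character_leftRegular [NeZero ν] (g : Cyc ν) :
    (Representation.leftRegular ℂ (Cyc ν)).character g = if g = 1 then (ν : ℂ) else 0 := by
  let b : Module.Basis (Cyc ν) ℂ (MonoidAlgebra ℂ (Cyc ν)) :=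
    Module.Basis.ofRepr (MonoidAlgebra.coeffLinearEquiv ℂ)
  have hb : ∀ h, b h = MonoidAlgebra.single h 1 := fun h => rfl
  rw [Representation.character, LinearMap.trace_eq_matrix_trace ℂ b, Matrix.trace]
  have : ∀ h : Cyc ν, Matrix.diag (LinearMap.toMatrix b b
      (Representation.leftRegular ℂ (Cyc ν) g)) h = if g = 1 then 1 else 0 := by
    intro h
    rw [Matrix.diag_apply, LinearMap.toMatrix_apply, hb, Representation.ofMulAction_single]
    change (MonoidAlgebra.single (g * h) (1 : ℂ)).coeff h = _
    rw [MonoidAlgebra.coeff_single, Finsupp.single_apply]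
    simp
  rw [Finset.sum_congr rfl fun h _ => this h, Finset.sum_const, Finset.card_univ,
    Fintype.card_multiplicative, ZMod.card]
  simp

theorem regDot_apply [NeZero ν] (g : Cyc ν) :
    regDot ν g = ((if g = 1 then (ν : ℂ) else 0) - 1) / (ν - 1) := by
  rw [regDot, character_leftRegular]

theorem natCast_sub_one_ne_zero (hν : 1 < ν) : (ν : ℂ) - 1 ≠ 0 := by
  rw [sub_ne_zero]
  exact_mod_cast hν.ne'

theorem regDot_one [NeZero ν] (hν : 1 < ν) : regDot ν 1 = 1 := by
  rw [regDot_apply, if_pos rfl, div_self (natCast_sub_one_ne_zero hν)]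

/-- The component of `g` at `s`, the identity if `s ∉ S`. -/
def component {S : Finset ℕ} (g : Q ν S) (s : ℕ) : Cyc ν := if h : s ∈ S then g ⟨s, h⟩ else 1

theorem component_coe {S : Finset ℕ} (g : Q ν S) (s : S) : component g s = g s := dif_pos s.2

theorem component_tr {V : Finset ℕ} (U : Finset ℕ) (g : Q ν V) (s : ℕ) :
    component (tr U g) s = if s ∈ U then component g s else 1 := by
  unfold component tr
  split_ifs <;> rfl

variable (ν) in
/-- The product of the `θ` over the components outside `I`. -/
noncomputable def chiProd [NeZero ν] (S I : Finset ℕ) : Cf ν S :=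
  fun g => ∏ s ∈ S \ I, regDot ν (component g s)

/-- A block is a product of independent choices, trivial at indices in `I` and any nontrivial
character elsewhere, so the sum factors. Orthogonality evaluates the sum over all characters of
`C_ν`, from which the trivial one is subtracted. -/
theorem chi_apply [NeZero ν] (hν : 1 < ν) {S I : Finset ℕ} (hI : I ⊆ S) (g : Q ν S) :
    chi ν S I g =
      ∏ s : S, if (s : ℕ) ∈ I then 1 else ((if g s = 1 then (ν : ℂ) else 0) - 1) := by
  classical
  let t : S → Finset (AddChar (ZMod ν) ℂ) := fun s =>
    if (s : ℕ) ∈ I then {0} else Finset.univ.erase 0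
  have hset : charBlock (lattice ν S) (subQ ν S I) = prodChar '' ↑(Fintype.piFinset t) := by
    ext f
    rw [mem_charBlock_iff hν hI, Set.mem_image]
    refine exists_congr fun ψ => and_congr_left fun _ => ?_
    rw [Finset.mem_coe, Fintype.mem_piFinset]
    refine forall_congr' fun s => ?_
    by_cases hs : (s : ℕ) ∈ I <;> simp [t, hs]
  rw [chi, supercharacter, hset, finsum_mem_image prodChar_injective.injOn,
    finsum_mem_coe_finset]
  simp only [prodChar_one, one_mul]
  simp only [prodChar]
  rw [← Finset.prod_univ_sum t fun s (ψ : AddChar (ZMod ν) ℂ) => ψ (g s).toAdd]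
  refine Finset.prod_congr rfl fun s _ => ?_
  by_cases hs : (s : ℕ) ∈ I
  · simp [t, hs]
  · simp only [t, if_neg hs]
    rw [Finset.sum_erase_eq_sub (Finset.mem_univ _), AddChar.sum_apply_eq_ite, ZMod.card,
      AddChar.zero_apply]
    rfl

theorem chiDot_eq_chiProd [NeZero ν] (hν : 1 < ν) {S I : Finset ℕ} (hI : I ⊆ S) :
    chiDot ν S I = chiProd ν S I := by
  funext g
  have h1 : (if (1 : Cyc ν) = 1 then (ν : ℂ) else 0) = ν := if_pos rfl
  rw [chiDot, chi_apply hν hI, chi_apply hν hI, ← Finset.prod_div_distrib]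
  have h2 : ∀ s : S, (if (s : ℕ) ∈ I then 1 else ((if g s = 1 then (ν : ℂ) else 0) - 1)) /
      (if (s : ℕ) ∈ I then 1 else ((if (1 : Q ν S) s = 1 then (ν : ℂ) else 0) - 1)) =
      if (s : ℕ) ∈ I then 1 else regDot ν (component g s) := by
    intro s
    rw [component_coe, regDot_apply, Pi.one_apply, h1]
    split_ifs <;> simp
  simp only [h2]
  rw [Finset.prod_coe_sort S fun s => if s ∈ I then 1 else regDot ν (component g s), chiProd,
    ← Finset.filter_notMem_eq_sdiff, Finset.prod_filter]
  exact Finset.prod_congr rfl fun s _ => by rw [ite_not]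

end QSymCat

namespace QSymCat

variable {ν : ℕ}

/-! ## The product of normalized supercharacters -/

theorem rankIn_orderEmbOfFin (S : Finset ℕ) {r : ℕ} (h : S.card = r) (j : Fin r) :
    rankIn S (S.orderEmbOfFin h j) = j + 1 := by
  have := rankIn_image (S.orderEmbOfFin h).strictMono j
  rwa [Finset.image_orderEmbOfFin_univ] at this

theorem exists_orderEmbOfFin_eq {S : Finset ℕ} {r : ℕ} (h : S.card = r) {p : ℕ} (hp : p ∈ S) :
    ∃ j, S.orderEmbOfFin h j = p := by
  have : p ∈ Set.range (S.orderEmbOfFin h) := by rwa [Finset.range_orderEmbOfFin]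
  exact this

theorem component_iota {S : Finset ℕ} (g : Q ν S) (j : Fin S.card) :
    component (iota S g) (j + 1) = component g (S.orderEmbOfFin rfl j) := by
  have hj : (j : ℕ) + 1 ∈ idx (S.card + 1) := Finset.mem_Icc.2 (by omega)
  rw [component, dif_pos hj, component, dif_pos (Finset.orderEmbOfFin_mem _ _ j)]
  rfl

/-- Standardization sends an element of `S` to its rank, counted from `1`. -/
theorem prod_component_iota {S : Finset ℕ} (I : Finset ℕ) (F : Cyc ν → ℂ) (g : Q ν S) :
    ∏ i ∈ Finset.Icc 1 S.card \ I, F (component (iota S g) i) =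
      ∏ p ∈ S with rankIn S p ∉ I, F (component g p) := by
  symm
  refine Finset.prod_nbij (rankIn S) ?_ ?_ ?_ ?_
  · intro p hp
    rw [Finset.mem_filter] at hp
    obtain ⟨j, rfl⟩ := exists_orderEmbOfFin_eq rfl hp.1
    refine Finset.mem_sdiff.2 ⟨?_, hp.2⟩
    rw [rankIn_orderEmbOfFin, Finset.mem_Icc]
    omega
  · intro p hp q hq h
    obtain ⟨j, rfl⟩ := exists_orderEmbOfFin_eq rfl (Finset.mem_filter.1 hp).1
    obtain ⟨k, rfl⟩ := exists_orderEmbOfFin_eq rfl (Finset.mem_filter.1 hq).1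
    rw [rankIn_orderEmbOfFin, rankIn_orderEmbOfFin] at h
    congr 1
    exact Fin.ext (by omega)
  · intro i hi
    rw [Finset.mem_coe, Finset.mem_sdiff, Finset.mem_Icc] at hi
    have hr : rankIn S (S.orderEmbOfFin rfl ⟨i - 1, by omega⟩) = i := by
      rw [rankIn_orderEmbOfFin]
      simp only
      omega
    refine ⟨S.orderEmbOfFin rfl ⟨i - 1, by omega⟩, ?_, hr⟩
    rw [Finset.mem_coe, Finset.mem_filter, hr]
    exact ⟨Finset.orderEmbOfFin_mem _ _ _, hi.2⟩
  · intro p hp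
    obtain ⟨j, rfl⟩ := exists_orderEmbOfFin_eq rfl (Finset.mem_filter.1 hp).1
    rw [rankIn_orderEmbOfFin, component_iota]

theorem rankIn_Icc {a b p : ℕ} (hp : p ≤ b) : rankIn (Finset.Icc a b) p = p + 1 - a := by
  have : (Finset.Icc a b).filter (· ≤ p) = Finset.Icc a p := by
    ext x
    simp only [Finset.mem_filter, Finset.mem_Icc]
    omega
  rw [rankIn, this, Nat.card_Icc]

variable [NeZero ν]

/-- As `I ⊆ [m-1]` omits `m`, the extra `θ` only enlarges the range of the product from `[m-1]` to
`[m]`. -/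
theorem tensOne_chiProd {m : ℕ} (hm : m ≠ 0) {I : Finset ℕ} (hI : I ⊆ idx m)
    (g : Q ν (idx (m + 1))) : tensOne (chiProd ν (idx m) I) (regDot ν) g =
      ∏ i ∈ Finset.Icc 1 m \ I, regDot ν (component g i) := by
  have h1 : m ∉ idx m \ I := fun h => by
    have := Finset.mem_Icc.1 (Finset.mem_sdiff.1 h).1
    omega
  have h2 : Finset.Icc 1 m \ I = insert m (idx m \ I) := by
    ext x
    have : x ∈ I → x ∈ idx m := fun h => hI h
    simp only [idx, Finset.mem_sdiff, Finset.mem_Icc, Finset.mem_insert] at this ⊢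
    by_cases hx : x ∈ I
    · have := this hx
      simp only [hx, not_true_eq_false, and_false, or_false, false_iff]
      omega
    · simp only [hx, not_false_eq_true, and_true]
      omega
  rw [h2, Finset.prod_insert h1, mul_comm]
  change chiProd ν (idx m) I (tr (idx m) g) * regDot ν (component g m) = _
  congr 1
  refine Finset.prod_congr rfl fun i hi => ?_
  rw [component_tr, if_pos (Finset.mem_sdiff.1 hi).1]

theorem iotaStar_tensOne_chiProd {m : ℕ} (hm : m ≠ 0) {I S : Finset ℕ} (hI : I ⊆ idx m)
    (hS : S.card = m) (g : Q ν S) :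
    iotaStar S (tensOne (chiProd ν (idx m) I) (regDot ν)) g =
      ∏ p ∈ S with rankIn S p ∉ I, regDot ν (component g p) := by
  subst hS
  rw [iotaStar, tensOne_chiProd hm hI, ← prod_component_iota]
  refine Finset.prod_congr rfl fun i hi => ?_
  rw [component_tr, if_pos]
  simpa using (Finset.mem_sdiff.1 hi).1

theorem sA_chiProd {m n : ℕ} (hm : m ≠ 0) (hn : n ≠ 0) {I J A : Finset ℕ} (hI : I ⊆ idx m)
    (hJ : J ⊆ idx n) (hA : A ∈ (Finset.Icc 1 (m + n)).powersetCard n)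
    (g : Q ν (idx (m + n + 1))) :
    sA A (chiProd ν (idx m) I) (chiProd ν (idx n) J) g =
      ∏ p ∈ Finset.Icc 1 (m + n), if (if p ∈ A then rankIn A p ∈ J
        else rankIn (Finset.Icc 1 (m + n) \ A) p ∈ I) then 1 else regDot ν (component g p) := by
  obtain ⟨hA, hc⟩ := Finset.mem_powersetCard.1 hA
  have hc' : (Finset.Icc 1 (m + n) \ A).card = m := by
    rw [Finset.card_sdiff_of_subset hA, hc, Nat.card_Icc]
    omega
  rw [sA, tens, iotaStar_tensOne_chiProd hm hI hc', iotaStar_tensOne_chiProd hn hJ hc,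
    ← Finset.prod_sdiff hA, Finset.prod_filter, Finset.prod_filter]
  congr 1
  · refine Finset.prod_congr rfl fun p hp => ?_
    rw [component_tr, if_pos hp, ite_not]
    exact if_congr (by rw [if_neg (Finset.mem_sdiff.1 hp).2]) rfl rfl
  · refine Finset.prod_congr rfl fun p hp => ?_
    rw [component_tr, if_pos hp, ite_not]
    exact if_congr (by rw [if_pos hp]) rfl rfl

theorem chiProd_eq_prod_ite {S I T : Finset ℕ} (hS : S ⊆ T) (g : Q ν S) :
    chiProd ν S I g = ∏ p ∈ T, if p ∈ S ∧ p ∉ I then regDot ν (component g p) else 1 := by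
  rw [chiProd, ← Finset.prod_filter]
  refine Finset.prod_congr ?_ fun _ _ => rfl
  ext p
  simp only [Finset.mem_sdiff, Finset.mem_filter]
  exact ⟨fun h => ⟨hS h.1, h⟩, fun h => h.2⟩

/-- The two sides are compared factor by factor. Where the word changes between `p` and `p + 1`, the
restriction erases the factor of `s_A` and `χ̇^{e(A)}` supplies `1` for a descent and `θ` for an
ascent; elsewhere the factor of the word concerned survives. At `p = m + n` the restriction
substitutes the identity, where `θ` is `1`. -/
theorem mA_chiProd (hν : 1 < ν) {m n : ℕ} {I J A : Finset ℕ} (hI : I ⊆ idx m) (hJ : J ⊆ idx n)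
    (hA : A ∈ (Finset.Icc 1 (m + n)).powersetCard n) :
    mA A (chiProd ν (idx m) I) (chiProd ν (idx n) J) =
      chiProd ν (idx (m + n)) (shuffleDescents (m + n) A I J) := by
  have hmem := hA
  obtain ⟨hA, hc⟩ := Finset.mem_powersetCard.1 hA
  funext g
  unfold mA
  split_ifs with hm hn
  · subst hm
    -- With an empty first word the second occupies all positions, so no change of word occurs.
    obtain rfl : A = Finset.Icc 1 (0 + n) :=
      Finset.eq_of_subset_of_card_le hA (by rw [hc, Nat.card_Icc]; omega)
    have h1 : chiProd ν (idx 0) I 1 = 1 := by simp [chiProd]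
    beta_reduce
    rw [h1, one_mul]
    refine Finset.prod_congr ?_ fun p hp => ?_
    · ext p
      simp only [shuffleDescents, Finset.mem_sdiff, Finset.mem_filter, Finset.mem_Icc, not_and,
        zero_add]
      refine and_congr_right fun hp => ?_
      rw [if_pos (by omega), rankIn_Icc (by omega), Nat.add_sub_cancel]
      constructor
      · exact fun h _ h' => h (h' (by omega))
      · exact fun h h' => h hp fun _ => h'
    · rw [component_tr, if_pos]
      have := (Finset.mem_sdiff.1 hp).1
      rwa [zero_add] at this
  · subst hn
    obtain rfl : A = ∅ := Finset.card_eq_zero.1 hc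
    have h1 : chiProd ν (idx 0) J 1 = 1 := by simp [chiProd]
    beta_reduce
    rw [h1, mul_one]
    refine Finset.prod_congr ?_ fun p hp => ?_
    · ext p
      simp only [shuffleDescents, Finset.mem_sdiff, Finset.mem_filter, Finset.mem_Icc, not_and,
        Finset.notMem_empty, if_false, Finset.sdiff_empty, not_false_eq_true, true_and]
      refine and_congr_right fun hp => ?_
      have hp' : p ≤ m - 1 := hp.2
      rw [rankIn_Icc (by omega), Nat.add_sub_cancel]
      exact ⟨fun h _ => h, fun h => h hp⟩
    · rw [component_tr, if_pos]
      exact (Finset.mem_sdiff.1 hp).1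
  · have he : endPts (m + n) A ⊆ endPtsBar (m + n) A := Finset.subset_union_left
    have hbar : endPtsBar (m + n) A ⊆ Finset.Icc 1 (m + n) := by
      intro p hp
      rcases Finset.mem_union.1 hp with h | h
      · exact hA (Finset.mem_filter.1 h).1
      · exact (Finset.mem_sdiff.1 (Finset.mem_filter.1 h).1).1
    rw [tens, chiDot_eq_chiProd hν he, res, sA_chiProd hm hn hI hJ hmem,
      chiProd_eq_prod_ite hbar, ← Finset.prod_mul_distrib,
      chiProd_eq_prod_ite (T := Finset.Icc 1 (m + n)) (Finset.Icc_subset_Icc le_rfl (by omega))]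
    refine Finset.prod_congr rfl fun p hp => ?_
    have hp' := Finset.mem_Icc.1 hp
    have e1 : p ∈ idx (m + n) ↔ p ≠ m + n := by rw [Finset.mem_Icc]; omega
    have e2 : p ∈ idx (m + n + 1) := Finset.mem_Icc.2 (by omega)
    have e3 : p ∈ endPts (m + n) A ↔ p ∈ A ∧ p ≠ m + n ∧ p + 1 ∉ A := Finset.mem_filter
    -- Interval ends of either kind are exactly the positions before a change of word.
    have e4 : p ∈ endPtsBar (m + n) A ↔ p ≠ m + n ∧ (p ∈ A ↔ p + 1 ∉ A) := by
      rw [endPtsBar, Finset.mem_union, e3, endPts, Finset.mem_filter, Finset.mem_sdiff,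
        Finset.mem_sdiff, Finset.mem_Icc, Finset.mem_Icc]
      by_cases hpn : p = m + n
      · simp [hpn]
      · have : p + 1 ≤ m + n := by omega
        by_cases h1 : p ∈ A <;> by_cases h2 : p + 1 ∈ A <;> simp [h1, h2, hpn, hp', this]
    have e5 : p ∈ shuffleDescents (m + n) A I J ↔ p ≠ m + n ∧
        if p ∈ A then (p + 1 ∈ A → rankIn A p ∈ J)
        else (p + 1 ∉ A ∧ rankIn (Finset.Icc 1 (m + n) \ A) p ∈ I) := by
      rw [shuffleDescents, Finset.mem_filter, e1]
    simp only [component_tr, Finset.mem_sdiff, e1, e2, e3, e4, e5, if_true]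
    by_cases hpn : p = m + n
    · simp [hpn, regDot_one hν]
    · by_cases h1 : p ∈ A <;> by_cases h2 : p + 1 ∈ A <;>
        simp [h1, h2, hpn, regDot_one hν, ite_not]

theorem mulComponent_chiProd (hν : 1 < ν) {m n : ℕ} {I J : Finset ℕ} (hI : I ⊆ idx m)
    (hJ : J ⊆ idx n) :
    mulComponent ν m n (chiProd ν (idx m) I) (chiProd ν (idx n) J) =
      ∑ A ∈ (Finset.Icc 1 (m + n)).powersetCard n,
        chiProd ν (idx (m + n)) (shuffleDescents (m + n) A I J) := by
  rw [mulComponent, LinearMap.sum_apply, LinearMap.sum_apply]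
  exact Finset.sum_congr rfl fun A hA => mA_chiProd hν hI hJ hA

/-! ## The coproduct of normalized supercharacters -/

/-- The restriction puts the identity at index `k`, so that factor is `1` whether or not `k ∈ I`;
the other factors separate into those left and right of `k`. For `k = 0` and `k = n` the trivial
character is an empty product. -/
theorem coproductComponent_chiProd (hν : 1 < ν) {n k : ℕ} (hk : k ≤ n) {I : Finset ℕ}
    (hI : I ⊆ idx n) :
    coproductComponent ν n k (chiProd ν (idx n) I) =
      chiProd ν (idx k) (cutLeft k I) ⊗ₜ chiProd ν (idx (n - k)) (cutRight n k I) := by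
  have h0 : ∀ I : Finset ℕ, (1 : Cf ν (idx 0)) = chiProd ν (idx 0) I := by
    intro I
    funext g
    simp [chiProd]
  unfold coproductComponent
  split_ifs with h hk0
  · obtain ⟨h1, h2⟩ := h
    rw [LinearMap.comp_apply, unglue, LinearEquiv.coe_coe, LinearEquiv.symm_apply_eq]
    funext g
    have hcard : (Finset.Icc (k + 1) (n - 1)).card = n - k - 1 := by rw [Nat.card_Icc]; omega
    have hl : chiProd ν (idx (n - k)) (cutRight n k I)
        (tr (idx (n - k)) (iota (Finset.Icc (k + 1) (n - 1)) (tr _ g))) =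
        ∏ p ∈ Finset.Icc (k + 1) (n - 1), if p ∈ I then 1 else regDot ν (component g p) := by
      have h3 : chiProd ν (idx (n - k)) (cutRight n k I)
          (tr (idx (n - k)) (iota (Finset.Icc (k + 1) (n - 1)) (tr _ g))) =
          ∏ i ∈ Finset.Icc 1 (Finset.Icc (k + 1) (n - 1)).card \ cutRight n k I,
            regDot ν (component (iota (Finset.Icc (k + 1) (n - 1)) (tr _ g)) i) := by
        refine Finset.prod_congr (by rw [hcard]) fun i hi => ?_
        have hi := (Finset.mem_sdiff.1 hi).1
        rw [hcard] at hi
        rw [component_tr, if_pos hi]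
      rw [h3, prod_component_iota, Finset.prod_filter]
      refine Finset.prod_congr rfl fun p hp => ?_
      have hp' := Finset.mem_Icc.1 hp
      rw [component_tr, if_pos hp, rankIn_Icc hp'.2, ite_not]
      refine if_congr ?_ rfl rfl
      rw [cutRight, Finset.mem_filter, Finset.mem_Icc,
        show p + 1 - (k + 1) + k = p by omega]
      exact and_iff_right (by omega)
    have hr : chiProd ν (idx k) (cutLeft k I) (tr (idx k) g) =
        ∏ p ∈ Finset.Icc 1 (k - 1), if p ∈ I then 1 else regDot ν (component g p) := by
      rw [chiProd, ← Finset.filter_notMem_eq_sdiff, Finset.prod_filter]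
      refine Finset.prod_congr rfl fun p hp => ?_
      rw [component_tr, if_pos hp, ite_not]
      refine if_congr ?_ rfl rfl
      rw [cutLeft, Finset.mem_filter]
      exact and_iff_right hp
    have hd : Disjoint (Finset.Icc 1 (k - 1)) (Finset.Icc (k + 1) (n - 1)) := by
      rw [Finset.disjoint_left]
      intro a ha hb
      rw [Finset.mem_Icc] at ha hb
      omega
    have hsub : cutIdx n k ⊆ idx n := by
      intro p hp
      rw [Finset.mem_union, Finset.mem_Icc, Finset.mem_Icc] at hp
      rw [Finset.mem_Icc]
      omega
    change chiProd ν (idx n) I (tr (idx n) g) = chiProd ν (idx k) (cutLeft k I) (tr (idx k) g) *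
      chiProd ν (idx (n - k)) (cutRight n k I)
        (tr (idx (n - k)) (iota (Finset.Icc (k + 1) (n - 1)) (tr _ g)))
    rw [hl, hr, ← Finset.prod_union hd, chiProd_eq_prod_ite (Finset.Subset.refl _),
      ← Finset.prod_sdiff hsub]
    rw [Finset.prod_eq_one, one_mul]
    · refine Finset.prod_congr rfl fun p hp => ?_
      rw [component_tr, if_pos (hsub hp)]
      by_cases hpI : p ∈ I <;> simp [hpI, hsub hp]
    · intro p hp
      have : component g p = 1 := dif_neg (Finset.mem_sdiff.1 hp).2
      rw [component_tr, this, ite_self, regDot_one hν, ite_self]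
  · subst hk0
    rw [LinearMap.comp_apply, TensorProduct.mk_apply, h0 (cutLeft 0 I)]
    congr 1
    funext g
    refine Finset.prod_congr ?_ fun p hp => ?_
    · ext p
      rw [Finset.mem_sdiff, Finset.mem_sdiff, cutRight, Finset.mem_filter, Nat.sub_zero]
      simp only [add_zero]
      tauto
    · rw [component_tr, if_pos (show p ∈ idx n from (Finset.mem_sdiff.1 hp).1)]
  · obtain rfl : k = n := by omega
    rw [LinearMap.comp_apply, LinearMap.flip_apply, TensorProduct.mk_apply]
    have h1 : (1 : Cf ν (idx (k - k))) = chiProd ν (idx (k - k)) (cutRight k k I) := by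
      rw [Nat.sub_self]
      exact h0 _
    rw [h1]
    congr 1
    funext g
    refine Finset.prod_congr ?_ fun p hp => ?_
    · ext p
      rw [Finset.mem_sdiff, Finset.mem_sdiff, cutLeft, Finset.mem_filter]
      tauto
    · rw [component_tr, if_pos (Finset.mem_sdiff.1 hp).1]

end QSymCat

namespace QSymCat

variable {ν : ℕ}

/-! ## The basis of normalized supercharacters -/

theorem mem_superclass_iff (hν : 1 < ν) {S I : Finset ℕ} (hI : I ⊆ S) (g : Q ν S) :
    g ∈ superclass (lattice ν S) (subQ ν S I) ↔ ∀ s ∈ S, s ∈ I ↔ component g s ≠ 1 := by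
  constructor
  · rintro ⟨h1, h2⟩ s hs
    have hg : component g s = g ⟨s, hs⟩ := dif_pos hs
    rw [hg]
    refine ⟨fun hsI hg1 => ?_, fun h => by_contra fun hsI => h (h1 ⟨s, hs⟩ hsI)⟩
    have hc := covers_insert hν ((Finset.erase_subset s I).trans hI) hs (Finset.notMem_erase s I)
    rw [Finset.insert_erase hsI] at hc
    refine h2 _ hc fun t ht => ?_
    by_cases hts : (t : ℕ) = s
    · obtain rfl : t = ⟨s, hs⟩ := Subtype.ext hts
      exact hg1
    · exact h1 t fun htI => ht (Finset.mem_erase.2 ⟨hts, htI⟩)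
  · intro h
    have hg : ∀ s : S, (s : ℕ) ∈ I ↔ g s ≠ 1 := fun s => by rw [h s s.2, component_coe]
    refine ⟨fun s hs => by_contra fun h => hs ((hg s).2 h), ?_⟩
    rintro _ ⟨⟨J, hJ, rfl⟩, -, hlt, -⟩ hmem
    refine hlt.not_ge (subQ_mono fun s hs hsI => by_contra fun hsJ => ?_)
    exact (hg ⟨s, hs⟩).1 hsI (hmem ⟨s, hs⟩ hsJ)

/-- The superclasses are the sets of elements with a given support, so superfunctions are the
functions of the support. -/
theorem mem_scf_iff (hν : 1 < ν) {n : ℕ} (f : Cf ν (idx n)) :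
    f ∈ scf ν n ↔ ∀ g h : Q ν (idx n),
      (∀ s ∈ idx n, component g s = 1 ↔ component h s = 1) → f g = f h := by
  constructor
  · intro hf g h hgh
    refine hf _ ⟨(idx n).filter fun s => component g s ≠ 1, Finset.filter_subset _ _, rfl⟩ g ?_ h ?_
    · rw [mem_superclass_iff hν (Finset.filter_subset _ _)]
      exact fun s hs => by rw [Finset.mem_filter, and_iff_right hs]
    · rw [mem_superclass_iff hν (Finset.filter_subset _ _)]
      exact fun s hs => by rw [Finset.mem_filter, and_iff_right hs, Ne, hgh s hs]
  · rintro hf _ ⟨I, hI, rfl⟩ g hg h hh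
    rw [mem_superclass_iff hν hI] at hg hh
    exact hf g h fun s hs => not_iff_not.1 ((hg s hs).symm.trans (hh s hs))

/-- The element of `Q_S(ν)` with support `I ∩ S` and all other components equal to the generator. -/
def supportPoint (S I : Finset ℕ) : Q ν S :=
  fun s => if (s : ℕ) ∈ I then Multiplicative.ofAdd 1 else 1

theorem component_supportPoint (hν : 1 < ν) {S I : Finset ℕ} {s : ℕ} (hs : s ∈ S) :
    component (supportPoint S I : Q ν S) s = 1 ↔ s ∉ I := by
  have : Fact (1 < ν) := ⟨hν⟩
  rw [component, dif_pos hs, supportPoint]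
  split_ifs with h
  · simp only [h, not_true_eq_false, iff_false]
    exact fun h1 => one_ne_zero (Multiplicative.ofAdd.injective h1 : (1 : ZMod ν) = 0)
  · simp [h]

variable [NeZero ν]

theorem chiProd_mem_scf (hν : 1 < ν) (n : ℕ) (I : Finset ℕ) : chiProd ν (idx n) I ∈ scf ν n := by
  rw [mem_scf_iff hν]
  intro g h hgh
  refine Finset.prod_congr rfl fun s hs => ?_
  rw [regDot_apply, regDot_apply]
  simp only [hgh s (Finset.mem_sdiff.1 hs).1]

/-- The indicator function of the superclass of the elements with support `I`, as a linear
combination of the normalized supercharacters. -/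
noncomputable def indicator (ν : ℕ) [NeZero ν] (n : ℕ) (I : Finset ℕ) : Cf ν (idx n) :=
  ∑ K ∈ (idx n).powerset,
    ((∏ s ∈ K, if s ∈ I then ((ν : ℂ) - 1) / ν else 1 / ν) *
      ∏ s ∈ idx n \ K, if s ∈ I then -(((ν : ℂ) - 1) / ν) else ((ν : ℂ) - 1) / ν) •
    chiProd ν (idx n) K

theorem indicator_mem_span (n : ℕ) (I : Finset ℕ) :
    indicator ν n I ∈ Submodule.span ℂ
      (Set.range fun K : (idx n).powerset => chiProd ν (idx n) K) :=
  Submodule.sum_mem _ fun K hK =>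
    Submodule.smul_mem _ _ (Submodule.subset_span ⟨⟨K, hK⟩, rfl⟩)

/-- Lagrange interpolation on the two values of `θ`, one factor per index: `(ν-1)/ν · (1 - θ)`
detects a nontrivial component and `1/ν + (ν-1)/ν · θ` a trivial one. In the expansion, `K` collects
the indices where the constant term is taken. -/
theorem indicator_apply (hν : 1 < ν) (n : ℕ) (I : Finset ℕ) (g : Q ν (idx n))
    [Decidable (∀ s ∈ idx n, s ∈ I ↔ component g s ≠ 1)] :
    indicator ν n I g = if ∀ s ∈ idx n, s ∈ I ↔ component g s ≠ 1 then 1 else 0 := by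
  have h0 : (ν : ℂ) ≠ 0 := NeZero.ne _
  have h1 := natCast_sub_one_ne_zero hν
  have hprod : indicator ν n I g = ∏ s ∈ idx n,
      ((if s ∈ I then ((ν : ℂ) - 1) / ν else 1 / ν) +
        (if s ∈ I then -(((ν : ℂ) - 1) / ν) else ((ν : ℂ) - 1) / ν) *
          regDot ν (component g s)) := by
    rw [Finset.prod_add, indicator, Finset.sum_apply]
    refine Finset.sum_congr rfl fun K _ => ?_
    rw [Pi.smul_apply, smul_eq_mul, Finset.prod_mul_distrib, ← mul_assoc]
    rfl
  have hfac : ∀ s, ((if s ∈ I then ((ν : ℂ) - 1) / ν else 1 / ν) +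
      (if s ∈ I then -(((ν : ℂ) - 1) / ν) else ((ν : ℂ) - 1) / ν) *
        regDot ν (component g s)) = if s ∈ I ↔ component g s ≠ 1 then 1 else 0 := by
    intro s
    rw [regDot_apply]
    by_cases hs : s ∈ I <;> by_cases hg : component g s = 1 <;> simp only [hs, hg, ne_eq,
      not_true_eq_false, not_false_eq_true, if_true, if_false, iff_true, iff_false]
    all_goals field_simp
    all_goals ring
  rw [hprod]
  simp only [hfac]
  rw [Finset.prod_ite_zero, Finset.prod_const_one]
  split_ifs <;> rfl

theorem eq_sum_indicator (hν : 1 < ν) {n : ℕ} {f : Cf ν (idx n)} (hf : f ∈ scf ν n) :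
    f = ∑ I ∈ (idx n).powerset, f (supportPoint (idx n) I) • indicator ν n I := by
  classical
  rw [mem_scf_iff hν] at hf
  funext g
  rw [Finset.sum_apply]
  simp only [Pi.smul_apply, indicator_apply hν, smul_eq_mul, mul_ite, mul_one, mul_zero]
  rw [Finset.sum_eq_single ((idx n).filter fun s => component g s ≠ 1)]
  · rw [if_pos]
    · refine hf _ _ fun s hs => ?_
      rw [component_supportPoint hν hs, Finset.mem_filter, and_iff_right hs, not_not]
    · exact fun s hs => by rw [Finset.mem_filter, and_iff_right hs]
  · intro I hI hne
    rw [if_neg]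
    intro h
    apply hne
    ext s
    rw [Finset.mem_filter]
    exact ⟨fun hs => ⟨Finset.mem_powerset.1 hI hs, (h s (Finset.mem_powerset.1 hI hs)).1 hs⟩,
      fun hs => (h s hs.1).2 hs.2⟩
  · intro h
    exact absurd (Finset.mem_powerset.2 (Finset.filter_subset _ _)) h

/-- The normalized supercharacter `χ̇^I(ν)` as an element of the supercharacter function space. -/
noncomputable def chiScf (hν : 1 < ν) (n : ℕ) (I : (idx n).powerset) : scf ν n :=
  ⟨chiProd ν (idx n) I, chiProd_mem_scf hν n I⟩

theorem span_chiScf (hν : 1 < ν) (n : ℕ) : ⊤ ≤ Submodule.span ℂ (Set.range (chiScf hν n)) := by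
  rintro ⟨f, hf⟩ -
  have hmem : f ∈ Submodule.span ℂ (Set.range fun K : (idx n).powerset => chiProd ν (idx n) K) := by
    rw [eq_sum_indicator hν hf]
    exact Submodule.sum_mem _ fun I _ => Submodule.smul_mem _ _ (indicator_mem_span n I)
  have hr : (Set.range fun K : (idx n).powerset => chiProd ν (idx n) K) =
      (scf ν n).subtype '' Set.range (chiScf hν n) := by
    rw [← Set.range_comp]
    rfl
  rw [hr, ← Submodule.map_span] at hmem
  obtain ⟨x, hx, rfl⟩ := hmem
  exact hx

theorem indicator_mem_scf (hν : 1 < ν) (n : ℕ) (I : Finset ℕ) : indicator ν n I ∈ scf ν n :=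
  Submodule.sum_mem _ fun _ _ => Submodule.smul_mem _ _ (chiProd_mem_scf hν n _)

/-- Evaluation at one representative per support is an isomorphism, the indicators providing
preimages. Together with the spanning property this count gives a basis. -/
theorem finrank_scf (hν : 1 < ν) (n : ℕ) :
    Module.finrank ℂ (scf ν n) = Fintype.card (idx n).powerset := by
  classical
  let ev : scf ν n →ₗ[ℂ] ((idx n).powerset → ℂ) :=
    LinearMap.funLeft ℂ ℂ (fun I : (idx n).powerset => (supportPoint (idx n) I : Q ν (idx n))) ∘ₗ
      (scf ν n).subtype
  have hev : ∀ f I, ev f I = (f : Cf ν (idx n)) (supportPoint (idx n) I) := fun f I => rfl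
  have hbij : Function.Bijective ev := by
    constructor
    · intro f f' h
      apply Subtype.ext
      rw [eq_sum_indicator hν f.2, eq_sum_indicator hν f'.2]
      refine Finset.sum_congr rfl fun I hI => ?_
      have := congrFun h ⟨I, hI⟩
      rw [hev, hev] at this
      rw [this]
    · intro c
      refine ⟨∑ I, c I • ⟨indicator ν n I, indicator_mem_scf hν n I⟩, ?_⟩
      funext J
      rw [map_sum, Finset.sum_apply, Finset.sum_eq_single J]
      · rw [map_smul, Pi.smul_apply, hev]
        dsimp only
        rw [indicator_apply hν, if_pos, smul_eq_mul, mul_one]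
        intro s hs
        rw [Ne, component_supportPoint hν hs, not_not]
      · intro I _ hIJ
        rw [map_smul, Pi.smul_apply, hev]
        dsimp only
        rw [indicator_apply hν, if_neg, smul_zero]
        intro h
        apply hIJ
        apply Subtype.ext
        ext s
        have hI := Finset.mem_powerset.1 I.2
        have hJ := Finset.mem_powerset.1 J.2
        have h' : ∀ s ∈ idx n, s ∈ (I : Finset ℕ) ↔ s ∈ (J : Finset ℕ) := fun s hs => by
          rw [h s hs, Ne, component_supportPoint hν hs, not_not]
        exact ⟨fun hs => (h' s (hI hs)).1 hs, fun hs => (h' s (hJ hs)).2 hs⟩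
      · simp
  rw [(LinearEquiv.ofBijective ev hbij).finrank_eq, Module.finrank_fintype_fun_eq_card]

/-- The basis of normalized supercharacters of `scf(𝒩_n(ν))`. -/
noncomputable def basisScf (hν : 1 < ν) (n : ℕ) :
    Module.Basis (idx n).powerset ℂ (scf ν n) :=
  basisOfTopLeSpanOfCardEqFinrank (chiScf hν n) (span_chiScf hν n) (finrank_scf hν n).symm

/-- The basis of normalized supercharacters of `⨁_n scf(𝒩_n(ν))`. -/
noncomputable def basisScfSum (hν : 1 < ν) : Module.Basis SetIndex ℂ (ScfSum ν) :=
  DFinsupp.basis (basisScf hν)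

theorem basisScfSum_apply (hν : 1 < ν) (x : SetIndex) :
    basisScfSum hν x = DirectSum.lof ℂ ℕ (fun n => scf ν n) x.1 (chiScf hν x.1 x.2) := by
  have h : basisScf hν x.1 x.2 = chiScf hν x.1 x.2 := by simp [basisScf]
  rw [← h]
  change (DFinsupp.mapRange.linearEquiv fun n => (basisScf hν n).repr).symm
    (sigmaFinsuppLequivDFinsupp ℂ (Finsupp.single x (1 : ℂ))) =
      DFinsupp.single x.1 (basisScf hν x.1 x.2)
  rw [LinearEquiv.symm_apply_eq]
  have h1 : sigmaFinsuppLequivDFinsupp ℂ (Finsupp.single x (1 : ℂ)) =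
      DFinsupp.single x.1 (Finsupp.single x.2 1) := sigmaFinsuppEquivDFinsupp_single x 1
  rw [h1, DFinsupp.mapRange.linearEquiv_apply, DFinsupp.mapRange_single, Module.Basis.repr_self]

end QSymCat

namespace QSymCat

variable {ν : ℕ} [NeZero ν]

/-! ## The isomorphism `ch_ν` -/

/-- The isomorphism `ch_ν` of vector spaces. -/
noncomputable def chEquiv (hν : 1 < ν) : ScfSum ν ≃ₗ[ℂ] QSym :=
  (basisScfSum hν).equiv basisL (Equiv.refl _)

theorem chEquiv_basisScfSum (hν : 1 < ν) (x : SetIndex) :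
    chEquiv hν (basisScfSum hν x) = fundamental x := by
  simp [chEquiv]

theorem chEquiv_lof (hν : 1 < ν) (x : SetIndex) :
    chEquiv hν (DirectSum.lof ℂ ℕ (fun n => scf ν n) x.1 (chiScf hν x.1 x.2)) =
      fundamental x := by
  rw [← basisScfSum_apply, chEquiv_basisScfSum]

theorem chiScf_eq_chiDot (hν : 1 < ν) {n : ℕ} {I : Finset ℕ} (hI : I ⊆ idx n)
    (h : chiDot ν (idx n) I ∈ scf ν n) :
    (⟨chiDot ν (idx n) I, h⟩ : scf ν n) = chiScf hν n ⟨I, Finset.mem_powerset.2 hI⟩ :=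
  Subtype.ext (chiDot_eq_chiProd hν hI)

theorem sendsChiToL_chEquiv (hν : 1 < ν) : SendsChiToL ν (chEquiv hν).toLinearMap := by
  intro n I hI
  have h : chiDot ν (idx n) I ∈ scf ν n := by
    rw [chiDot_eq_chiProd hν hI]
    exact chiProd_mem_scf hν n I
  refine ⟨h, ?_⟩
  rw [chiScf_eq_chiDot hν hI, LinearEquiv.coe_coe, L_comp hI]
  exact congrArg Subtype.val (chEquiv_lof hν ⟨n, I, Finset.mem_powerset.2 hI⟩)

theorem eq_chEquiv_of_sendsChiToL (hν : 1 < ν) {f : ScfSum ν →ₗ[ℂ] QSym}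
    (hf : SendsChiToL ν f) : f = (chEquiv hν).toLinearMap := by
  apply (basisScfSum hν).ext
  rintro ⟨n, I, hI⟩
  have hI' := Finset.mem_powerset.1 hI
  rw [LinearEquiv.coe_coe, chEquiv_basisScfSum, basisScfSum_apply]
  apply Subtype.ext
  obtain ⟨h, h'⟩ := hf n I hI'
  rw [chiScf_eq_chiDot hν hI', L_comp hI'] at h'
  exact h'

/-! ### Transport of the Hopf structure to class functions -/

/-- The linear isomorphism from `QSymAlg` to `⨁_n scf(𝒩_n(ν))` inverse to `ch_ν`. -/
noncomputable def scfEquiv (hν : 1 < ν) : QSymAlg ≃ₗ[ℂ] ScfSum ν :=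
  algEquivQSym.trans (chEquiv hν).symm

/-- The embedding of `QSymAlg` into `⨁_n cf(Q_n(ν))`. -/
noncomputable def cfEmbedding (hν : 1 < ν) : QSymAlg →ₗ[ℂ] CfSum ν :=
  incl ν ∘ₗ (scfEquiv hν).toLinearMap

theorem cfEmbedding_fundamentalAlg (hν : 1 < ν) {n : ℕ} {I : Finset ℕ} (hI : I ⊆ idx n) :
    cfEmbedding hν (fundamentalAlg n I hI) =
      DirectSum.lof ℂ ℕ (fun n => Cf ν (idx n)) n (chiProd ν (idx n) I) := by
  have h : scfEquiv hν (fundamentalAlg n I hI) = DirectSum.lof ℂ ℕ (fun n => scf ν n) n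
      (chiScf hν n ⟨I, Finset.mem_powerset.2 hI⟩) := by
    change (chEquiv hν).symm (fundamental ⟨n, I, Finset.mem_powerset.2 hI⟩) = _
    rw [LinearEquiv.symm_apply_eq]
    exact (chEquiv_lof hν ⟨n, I, Finset.mem_powerset.2 hI⟩).symm
  rw [cfEmbedding, LinearMap.comp_apply, LinearEquiv.coe_coe, h, incl, DirectSum.lmap_lof]
  rfl

/-- The basis of fundamental quasisymmetric functions of `QSymAlg`. -/
noncomputable def basisLAlg : Module.Basis SetIndex ℂ QSymAlg := basisL.map algEquivQSym.symm

theorem basisLAlg_apply (x : SetIndex) : basisLAlg x = fundamentalAlg x.1 x.2 x.subset := by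
  rw [basisLAlg, Module.Basis.map_apply, basisL_apply]
  rfl

theorem product_lof (m n : ℕ) (φ : Cf ν (idx m)) (ψ : Cf ν (idx n)) :
    product ν (DirectSum.lof ℂ ℕ (fun n => Cf ν (idx n)) m φ)
      (DirectSum.lof ℂ ℕ (fun n => Cf ν (idx n)) n ψ) =
      DirectSum.lof ℂ ℕ (fun n => Cf ν (idx n)) (m + n) (mulComponent ν m n φ ψ) := by
  rw [product, DirectSum.toModule_lof, LinearMap.flip_apply, DirectSum.toModule_lof,
    LinearMap.flip_apply, LinearMap.compr₂_apply]

theorem fundamentalAlg_mul {m n : ℕ} {I J : Finset ℕ} (hI : I ⊆ idx m) (hJ : J ⊆ idx n) :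
    fundamentalAlg m I hI * fundamentalAlg n J hJ =
      ∑ A ∈ (Finset.Icc 1 (m + n)).powersetCard n,
        fundamentalAlg (m + n) (shuffleDescents (m + n) A I J)
          (shuffleDescents_subset (m + n) A I J) := by
  apply Subtype.ext
  rw [AddSubmonoidClass.coe_finsetSum]
  exact Lset_mul m n I J

/-- By bilinearity it suffices to treat basis elements, where both products are sums over the same
sets `A` with the same descent sets. -/
theorem cfEmbedding_mul (hν : 1 < ν) (a b : QSymAlg) :
    cfEmbedding hν (a * b) = product ν (cfEmbedding hν a) (cfEmbedding hν b) := by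
  have h : (LinearMap.mul ℂ QSymAlg).compr₂ (cfEmbedding hν) =
      (product ν).compl₁₂ (cfEmbedding hν) (cfEmbedding hν) := by
    refine basisLAlg.ext fun x => basisLAlg.ext fun y => ?_
    rw [LinearMap.compr₂_apply, LinearMap.mul_apply', LinearMap.compl₁₂_apply, basisLAlg_apply,
      basisLAlg_apply, fundamentalAlg_mul, map_sum, cfEmbedding_fundamentalAlg,
      cfEmbedding_fundamentalAlg, product_lof, mulComponent_chiProd hν x.subset y.subset, map_sum]
    exact Finset.sum_congr rfl fun A _ => cfEmbedding_fundamentalAlg hν _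
  exact DFunLike.congr_fun (DFunLike.congr_fun h a) b

theorem cfEmbedding_comul (hν : 1 < ν) (a : QSymAlg) :
    TensorProduct.map (cfEmbedding hν) (cfEmbedding hν) (Coalgebra.comul (R := ℂ) a) =
      coproduct ν (cfEmbedding hν a) := by
  have h : TensorProduct.map (cfEmbedding hν) (cfEmbedding hν) ∘ₗ Coalgebra.comul (R := ℂ) =
      coproduct ν ∘ₗ cfEmbedding hν := by
    refine basisLAlg.ext fun x => ?_
    rw [LinearMap.comp_apply, LinearMap.comp_apply, basisLAlg_apply, comul_fundamentalAlg,
      cfEmbedding_fundamentalAlg, coproduct, DirectSum.toModule_lof, map_sum,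
      LinearMap.sum_apply]
    refine Finset.sum_congr rfl fun k hk => ?_
    rw [TensorProduct.map_tmul, cfEmbedding_fundamentalAlg, cfEmbedding_fundamentalAlg,
      LinearMap.comp_apply,
      coproductComponent_chiProd hν (Nat.lt_succ_iff.1 (Finset.mem_range.1 hk)) x.subset,
      TensorProduct.map_tmul]
  exact DFunLike.congr_fun h a

end QSymCat

open QSymCat
theorem mainTheorem2 (ν : ℕ) [NeZero ν] (hν : 1 < ν) :
    -- the Hopf algebra `(⨁ₙ scf(𝒩ₙ(ν)), 𝐦, ▲)`
    ∃ (H : Type) (_ : Ring H) (_ : HopfAlgebra ℂ H) (j : H ≃ₗ[ℂ] ScfSum ν),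
      (∀ a b : H, incl ν (j (a * b)) = product ν (incl ν (j a)) (incl ν (j b))) ∧
      (∀ a : H, TensorProduct.map (incl ν ∘ₗ j.toLinearMap) (incl ν ∘ₗ j.toLinearMap)
        (Coalgebra.comul (R := ℂ) a) = coproduct ν (incl ν (j a))) ∧
    -- the Hopf algebra `QSym`, with the product of power series and the coproduct `△`
    ∃ (K : Type) (_ : Ring K) (_ : HopfAlgebra ℂ K) (i : K ≃ₗ[ℂ] QSym),
      (∀ a b : K, (i (a * b) : MvPowerSeries ℕ ℂ) = i a * i b) ∧
      (∀ a : K, TensorProduct.map i.toLinearMap i.toLinearMap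
        (Coalgebra.comul (R := ℂ) a) = coproductQSym (i a)) ∧
    -- the isomorphism `ch_ν`
    ∃ ch : ScfSum ν →ₗ[ℂ] QSym,
      SendsChiToL ν ch ∧ (∀ f : ScfSum ν →ₗ[ℂ] QSym, SendsChiToL ν f → f = ch) ∧
      ∃ e : H ≃ₐc[ℂ] K, ∀ a : H, i (e a) = ch (j a) := by
  -- The same abstract Hopf algebra serves for `H` and `K`, with two different linear
  -- identifications. The Hopf isomorphism is then the identity, and the final equation holds
  -- because `scfEquiv` is built from the inverse of `ch_ν`.
  refine ⟨QSymAlg, inferInstance, inferInstance, scfEquiv hν, cfEmbedding_mul hν,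
    cfEmbedding_comul hν, QSymAlg, inferInstance, inferInstance, algEquivQSym, fun _ _ => rfl,
    map_algEquivQSym_comul, (chEquiv hν).toLinearMap, sendsChiToL_chEquiv hν,
    fun f hf => eq_chEquiv_of_sendsChiToL hν hf, BialgEquiv.refl ℂ QSymAlg, fun a => ?_⟩
  exact ((chEquiv hν).apply_symm_apply (algEquivQSym a)).symm
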